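/- Let $d\ge 2$ and let $\Omega\subset\mathbb R^d$ be an open bounded convex domain with smooth boundary and outer unit normal $n$. Write $S\Omega=\Omega\times\mathbb S^{d-1}$, $S\Omega^2=\Omega\times\mathbb S^{d-1}\times\mathbb S^{d-1}$, $S\Omega_T=(0,T)\times S\Omega$, $\partial_\pm S\Omega=\{(x,v):x\in\partial\Omega,\ v\in\mathbb S^{d-1},\ \pm\langle n(x),v\rangle>0\}$, $\partial_\pm S\Omega_T=(0,T)\times\partial_\pm S\Omega$, let $d\omega$ be the rotation invariant probability measure on $\mathbb S^{d-1}$, and let $T>\operatorname{diam}\Omega$. Let $\sigma_1,\sigma_2\in L^\infty(S\Omega)$ and $\mu\in L^\infty(S\Omega^2)$ be such that, for some constants $\sigma^0,\mu^0>0$ and $j=1,2$, almost everywhere $$0\le\sigma_j(x,v)\le\sigma^0,\quad 0\le\mu(x,v',v)\le\mu^0,\quad \int_{\mathbb S^{d-1}}\mu(x,v,v')\,d\omega(v')\le\sigma_j(x,v),\quad \int_{\mathbb S^{d-1}}\mu(x,v',v)\,d\omega(v')\le\sigma_j(x,v).$$ Let $q_1,q_2\in L^\infty(S\Omega)$ and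 let $N_j(x,v,z)=q_j(x,v)N_0(z)$, where $N_0:\mathbb R\to\mathbb R$ is differentiable, its derivative is differentiable at $0$, $\partial_z^2N_0(0)>0$, and for some integer $\ell\ge2$ and constants $C_1,C_2>0$ $$|N_0(z)|\le C_1|z|^\ell,\qquad |\partial_zN_0(z)|\le C_2|z|^{\ell-1}\qquad\text{for all }z\in\mathbb R.$$ Fix $\gamma\in\mathbb S^{d-1}$ and $\gamma_0>0$, and let $\Lambda$ be the set of functions $p$ on $S\Omega$ with $p(x,v)=p(x,-v)$ for almost every $(x,v)$ and $p(x,v)=0$ for almost every $(x,v)$ with $|\gamma\cdot v|\le\gamma_0$. Assume that $\sigma_1,\sigma_2,q_1,q_2\in\Lambda$ and that $(x,v')\mapsto\mu(x,v',v)$ is in $\Lambda$ for almost every $v$. Let $\mathcal A_{\sigma,\mu,N}(f_0,f_-)=f|_{\partial_+S\Omega_T}$, where $f\in L^\infty(S\Omega_T)$ is the solution (in the sense of distributions, with traces taken along characteristics) of $$\partial_tf+v\cdot\nabla_xf+\sigma f+N(x,v,f)=\int_{\mathbb S^{d-1}}\mu(x,v',v)f(t,x,v')\,d\omega(v')\ \text{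 in }S\Omega_T,\qquad f|_{t=0}=f_0,\qquad f|_{\partial_-S\Omega_T}=f_-.$$ Suppose that, for some $\delta>0$ (which may be arbitrarily small), $\mathcal A_{\sigma_1,\mu,N_1}(h,0)=\mathcal A_{\sigma_2,\mu,N_2}(h,0)$ for every $h\in L^\infty(S\Omega)$ with $\|h\|_{L^\infty(S\Omega)}\le\delta$ for which both solutions exist (they do whenever $\|h\|_{L^\infty(S\Omega)}$ is small enough). Then $\sigma_1=\sigma_2$ and $q_1=q_2$ almost everywhere in $S\Omega$; hence $N_1(x,v,z)=N_2(x,v,z)$ for almost every $(x,v)\in S\Omega$ and all $z\in\mathbb R$. -/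

import Mathlib

open MeasureTheory Set Filter Topology
open scoped ContDiff

noncomputable section

namespace NonlinearTransport

/-- The Euclidean space `ℝ^d`. -/
abbrev Space (d : ℕ) : Type := EuclideanSpace ℝ (Fin d)

/-- The unit sphere `𝕊^{d-1}` of velocities. -/
abbrev Velocity (d : ℕ) : Type := Metric.sphere (0 : Space d) 1

variable {d : ℕ}

/-! ### The domain and its boundary -/

/-- `n` is the unit outer normal of `Ω` at the boundary point `x`, and `∂Ω` is smooth near `x`:
in a neighbourhood `U` of `x`, `Ω` is the sublevel set `{ρ < 0}` of a smooth function `ρ` whose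
gradient at `x` is a positive multiple of `n` (in particular it does not vanish). -/
def IsOuterNormal (Ω : Set (Space d)) (x n : Space d) : Prop :=
  ‖n‖ = 1 ∧ ∃ (U : Set (Space d)) (ρ : Space d → ℝ) (c : ℝ),
    IsOpen U ∧ x ∈ U ∧ ContDiffOn ℝ ∞ ρ U ∧ (∀ y ∈ U, y ∈ Ω ↔ ρ y < 0) ∧
      0 < c ∧ HasGradientAt ρ (c • n) x

/-- `Ω` has a smooth (`C^∞`) boundary. -/
def HasSmoothBoundary (Ω : Set (Space d)) : Prop :=
  ∀ x ∈ frontier Ω, ∃ n, IsOuterNormal Ω x n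

/-- The outgoing boundary `∂₊SΩ = {(x, v) : x ∈ ∂Ω, ⟨n(x), v⟩ > 0}`. -/
def outgoing (Ω : Set (Space d)) : Set (Space d × Velocity d) :=
  {z | z.1 ∈ frontier Ω ∧ ∃ n, IsOuterNormal Ω z.1 n ∧ 0 < inner ℝ n (z.2 : Space d)}

/-- The incoming boundary `∂₋SΩ = {(x, v) : x ∈ ∂Ω, ⟨n(x), v⟩ < 0}`. -/
def incoming (Ω : Set (Space d)) : Set (Space d × Velocity d) :=
  {z | z.1 ∈ frontier Ω ∧ ∃ n, IsOuterNormal Ω z.1 n ∧ inner ℝ n (z.2 : Space d) < 0}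

/-! ### Measures -/

/-- The rotation invariant measure `dω` on the sphere, normalized to total mass one. -/
def sphereMeasure (d : ℕ) : Measure (Velocity d) :=
  ((volume : Measure (Space d)).toSphere univ)⁻¹ • (volume : Measure (Space d)).toSphere

/-- The measure `dx dω(v)` on `SΩ = Ω × 𝕊^{d-1}`. -/
def phaseMeasure (Ω : Set (Space d)) : Measure (Space d × Velocity d) :=
  (volume.restrict Ω).prod (sphereMeasure d)

/-- The measure `dx dω(v') dω(v)` on `SΩ² = Ω × 𝕊^{d-1} × 𝕊^{d-1}`. -/
def phaseMeasure₂ (Ω : Set (Space d)) : Measure (Space d × Velocity d × Velocity d) :=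
  (volume.restrict Ω).prod ((sphereMeasure d).prod (sphereMeasure d))

/-- The measure `dx dω(v) dt` on `SΩ_T`; its points are written `((x, v), t)`. -/
def phaseTimeMeasure (Ω : Set (Space d)) (T : ℝ) : Measure ((Space d × Velocity d) × ℝ) :=
  (phaseMeasure Ω).prod (volume.restrict (Ioo 0 T))

/-- The measure `dλ(x) dω(v) dt` on `B × (0, T)`, where `B ⊆ ∂Ω × 𝕊^{d-1}` and the surface measure
`λ` of `∂Ω` is the `(d-1)`-dimensional Hausdorff measure. -/
def boundaryTimeMeasure (Ω : Set (Space d)) (B : Set (Space d × Velocity d)) (T : ℝ) :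
    Measure ((Space d × Velocity d) × ℝ) :=
  ((((Measure.hausdorffMeasure ((d : ℝ) - 1)).restrict (frontier Ω)).prod
    (sphereMeasure d)).restrict B).prod (volume.restrict (Ioo 0 T))

/-! ### Coefficients -/

/-- The standing assumptions on the absorption coefficient `σ(x, v)` and the scattering
coefficient `μ(x, v', v)`: they are bounded and nonnegative, and absorption dominates
scattering. -/
structure IsAdmissible (Ω : Set (Space d)) (σ : Space d × Velocity d → ℝ)
    (μ : Space d × Velocity d × Velocity d → ℝ) : Prop where
  memLp_absorption : MemLp σ ⊤ (phaseMeasure Ω)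
  memLp_scattering : MemLp μ ⊤ (phaseMeasure₂ Ω)
  absorption_bounds : ∃ σ₀ > 0, ∀ᵐ z ∂(phaseMeasure Ω), 0 ≤ σ z ∧ σ z ≤ σ₀
  scattering_bounds : ∃ μ₀ > 0, ∀ᵐ z ∂(phaseMeasure₂ Ω), 0 ≤ μ z ∧ μ z ≤ μ₀
  integral_outgoing_le : ∀ᵐ z ∂(phaseMeasure Ω),
    ∫ v', μ (z.1, z.2, v') ∂(sphereMeasure d) ≤ σ z
  integral_incoming_le : ∀ᵐ z ∂(phaseMeasure Ω),
    ∫ v', μ (z.1, v', z.2) ∂(sphereMeasure d) ≤ σ z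

/-- The set `Λ` (for a fixed direction `γ` and constant `γ₀`): functions that are even in `v` and
vanish where `|γ · v| ≤ γ₀`. -/
def MemLambda (Ω : Set (Space d)) (γ : Velocity d) (γ₀ : ℝ) (p : Space d × Velocity d → ℝ) :
    Prop :=
  (∀ᵐ z ∂(phaseMeasure Ω), p z = p (z.1, -z.2)) ∧
    ∀ᵐ z ∂(phaseMeasure Ω), |inner ℝ (γ : Space d) (z.2 : Space d)| ≤ γ₀ → p z = 0

/-! ### The initial boundary value problem and the measurement operator -/

/-- The scattering operator `K(f)(t, x, v) = ∫ μ(x, v', v) f(t, x, v') dω(v')`. -/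
def scattering (μ : Space d × Velocity d × Velocity d → ℝ)
    (f : (Space d × Velocity d) × ℝ → ℝ) (p : (Space d × Velocity d) × ℝ) : ℝ :=
  ∫ v', μ (p.1.1, v', p.1.2) * f ((p.1.1, v'), p.2) ∂(sphereMeasure d)

/-- `f` solves `∂_t f + v · ∇ₓ f + σ f + N(x, v, f) = K(f)` in `SΩ_T` in the sense of
distributions. Test functions on `SΩ_T` are restrictions to `v ∈ 𝕊^{d-1}` of smooth functions of
`((x, v), t) ∈ (ℝ^d × ℝ^d) × ℝ`, and the derivative of `φ` in the direction `((v, 0), 1)` is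
`∂_t φ + v · ∇ₓ φ`. -/
def IsWeakSolution (Ω : Set (Space d)) (T : ℝ) (σ : Space d × Velocity d → ℝ)
    (μ : Space d × Velocity d × Velocity d → ℝ) (N : Space d × Velocity d → ℝ → ℝ)
    (f : (Space d × Velocity d) × ℝ → ℝ) : Prop :=
  ∀ φ : (Space d × Space d) × ℝ → ℝ, ContDiff ℝ ∞ φ → HasCompactSupport φ →
    tsupport φ ⊆ {p | p.1.1 ∈ Ω ∧ p.2 ∈ Ioo 0 T} →
    ∫ p, f p * fderiv ℝ φ ((p.1.1, (p.1.2 : Space d)), p.2) (((p.1.2 : Space d), 0), 1)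
        ∂(phaseTimeMeasure Ω T) =
      ∫ p, (σ p.1 * f p + N p.1 (f p) - scattering μ f p) * φ ((p.1.1, (p.1.2 : Space d)), p.2)
        ∂(phaseTimeMeasure Ω T)

/-- `f = f₀` on `{0} × SΩ`. As `f` is only defined up to null sets, its trace is taken as the limit
of its averages along the characteristic `s ↦ (s, x + s v, v)` starting at `(0, x, v)`. -/
def HasInitialTrace (Ω : Set (Space d)) (f : (Space d × Velocity d) × ℝ → ℝ)
    (f₀ : Space d × Velocity d → ℝ) : Prop :=
  ∀ᵐ z ∂(phaseMeasure Ω),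
    Tendsto (fun ε : ℝ => ε⁻¹ * ∫ s in (0 : ℝ)..ε, f ((z.1 + s • (z.2 : Space d), z.2), s))
      (𝓝[>] 0) (𝓝 (f₀ z))

/-- `f = g` on `∂₋SΩ_T`, the trace being taken along the characteristics entering at
`∂₋SΩ_T`. -/
def HasIncomingTrace (Ω : Set (Space d)) (T : ℝ) (f g : (Space d × Velocity d) × ℝ → ℝ) : Prop :=
  ∀ᵐ p ∂(boundaryTimeMeasure Ω (incoming Ω) T),
    Tendsto (fun ε : ℝ => ε⁻¹ * ∫ s in (0 : ℝ)..ε,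
      f ((p.1.1 + s • (p.1.2 : Space d), p.1.2), p.2 + s)) (𝓝[>] 0) (𝓝 (g p))

/-- `f = g` on `∂₊SΩ_T`, the trace being taken along the characteristics leaving at
`∂₊SΩ_T`. -/
def HasOutgoingTrace (Ω : Set (Space d)) (T : ℝ) (f g : (Space d × Velocity d) × ℝ → ℝ) : Prop :=
  ∀ᵐ p ∂(boundaryTimeMeasure Ω (outgoing Ω) T),
    Tendsto (fun ε : ℝ => ε⁻¹ * ∫ s in (0 : ℝ)..ε,
      f ((p.1.1 - s • (p.1.2 : Space d), p.1.2), p.2 - s)) (𝓝[>] 0) (𝓝 (g p))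

/-- `f ∈ L^∞(SΩ_T)` solves the initial boundary value problem with initial data `f₀` and
incoming boundary data `fin`. -/
structure IsSolution (Ω : Set (Space d)) (T : ℝ) (σ : Space d × Velocity d → ℝ)
    (μ : Space d × Velocity d × Velocity d → ℝ) (N : Space d × Velocity d → ℝ → ℝ)
    (f₀ : Space d × Velocity d → ℝ) (fin f : (Space d × Velocity d) × ℝ → ℝ) : Prop where
  memLp : MemLp f ⊤ (phaseTimeMeasure Ω T)
  equation : IsWeakSolution Ω T σ μ N f
  initial : HasInitialTrace Ω f f₀
  boundary : HasIncomingTrace Ω T f fin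

/-- The graph of the measurement operator `A_{σ, μ, N}`: `A_{σ, μ, N}(f₀, fin) = g`, i.e. `g` is
the restriction to `∂₊SΩ_T` of the solution with data `(f₀, fin)`. -/
def IsMeasurement (Ω : Set (Space d)) (T : ℝ) (σ : Space d × Velocity d → ℝ)
    (μ : Space d × Velocity d × Velocity d → ℝ) (N : Space d × Velocity d → ℝ → ℝ)
    (f₀ : Space d × Velocity d → ℝ) (fin g : (Space d × Velocity d) × ℝ → ℝ) : Prop :=
  ∃ f, IsSolution Ω T σ μ N f₀ fin f ∧ HasOutgoingTrace Ω T f g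

end NonlinearTransport

end

open NonlinearTransport

namespace NonlinearTransport

variable {d : ℕ}

/-! ### The sphere measure -/

/-! Extend the coefficients by zero outside `Ω` and follow characteristics: F(y, v, t) = f(t, y +
tv, v) satisfies an integral equation on the whole space, solved by Picard iteration
(`IsCausalLipschitz.exists_solution`). By convexity a line does not meet `Ω` before an incoming
point or after an outgoing one, so the zero boundary condition is automatic and F is frozen after
the exit. As T exceeds the diameter, the measurement therefore determines F(·, ·, T) almost
everywhere on `Ω` × sphere (`ae_final_eq_of_ae_outgoing`). The hypothesis on the measurements
applies to any pair of solutions with the same datum, so only existence is needed.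

The data are λ on `Ω` × B and zero elsewhere, where B is a small ball of velocities with ω(B) ≤ λ².
The solution is bounded by a constant times λ(1_B + ω(B)), so scattering contributes only O(λ³).
Along a ray with velocity in B this leaves the scalar equation F' = -σF - qN₀(F) + O(λ³) with F(0) =
λ. Duhamel's formula then gives, as λ → 0, the limit exp(-∫σ) for F(T)/λ (`tendsto_div`) and the
limit -α∫q exp(-∫σ) for (F(T) exp(∫σ) - λ)/λ² (`tendsto_second_order`), where α = N₀''(0)/2 > 0.

Equal measurements thus give equal forward ray integrals of σ₁ and σ₂ from almost every interior
point, not only from the boundary. Differentiating in the starting point along the ray recovers the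
integrand (`ae_eq_zero_of_ae_ray_integral_eq_zero`), whence σ₁ = σ₂. The second-order terms then
carry the same attenuation, and the same differentiation gives q₁ = q₂. -/

instance : IsFiniteMeasure (sphereMeasure d) := by
  constructor
  rw [sphereMeasure, Measure.smul_apply, smul_eq_mul]
  rcases eq_or_ne ((volume : Measure (Space d)).toSphere univ) 0 with h | h
  · simp [h]
  · rw [ENNReal.inv_mul_cancel h (measure_ne_top _ _)]; simp

theorem isProbabilityMeasure_sphereMeasure (hd : 2 ≤ d) :
    IsProbabilityMeasure (sphereMeasure d) := by
  constructor
  have : Nontrivial (Space d) := by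
    have : Nonempty (Fin d) := ⟨⟨0, by omega⟩⟩
    infer_instance
  rw [sphereMeasure, Measure.smul_apply, smul_eq_mul]
  refine ENNReal.inv_mul_cancel ?_ (measure_ne_top _ _)
  rw [Ne, Measure.measure_univ_eq_zero]
  exact Measure.toSphere_ne_zero _

-- The cone over a point lies in a line, which is a proper subspace, hence Lebesgue null, when d ≥
-- 2. This lets velocity balls of arbitrarily small measure be chosen around any direction.
open scoped Pointwise in
theorem sphereMeasure_singleton (hd : 2 ≤ d) (v : Velocity d) : sphereMeasure d {v} = 0 := by
  rw [sphereMeasure, Measure.smul_apply, smul_eq_mul,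
    Measure.toSphere_apply' _ (measurableSet_singleton v)]
  have hsub : Ioo (0 : ℝ) 1 • ((↑) '' ({v} : Set (Velocity d)) : Set (Space d)) ⊆
      (Submodule.span ℝ {(v : Space d)} : Set (Space d)) := by
    rintro x ⟨r, -, y, ⟨w, rfl, rfl⟩, rfl⟩
    exact Submodule.smul_mem _ _ (Submodule.mem_span_singleton_self _)
  have hne : Submodule.span ℝ {(v : Space d)} ≠ ⊤ := by
    intro h
    have h1 := finrank_span_le_card (R := ℝ) ({(v : Space d)} : Set (Space d))
    rw [h, finrank_top, finrank_euclideanSpace_fin] at h1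
    simp at h1
    omega
  rw [measure_mono_null hsub (Measure.addHaar_submodule _ _ hne)]
  simp

/-! ### Shifts along characteristics -/

theorem measurePreserving_shift (t : ℝ) :
    MeasurePreserving (fun z : Space d × Velocity d => (z.1 + t • (z.2 : Space d), z.2))
      ((volume : Measure (Space d)).prod (sphereMeasure d))
      ((volume : Measure (Space d)).prod (sphereMeasure d)) := by
  have h := (MeasurePreserving.id (sphereMeasure d)).skew_product
    (μc := (volume : Measure (Space d))) (μd := volume)
    (g := fun (v : Velocity d) (y : Space d) => y + t • (v : Space d)) (by fun_prop)
    (ae_of_all _ fun v => (measurePreserving_add_right volume (t • (v : Space d))).map_eq)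
  exact (Measure.measurePreserving_swap.comp h).comp Measure.measurePreserving_swap

theorem measurePreserving_shear (ν : Measure ℝ) [SFinite ν] :
    MeasurePreserving
      (fun p : (Space d × Velocity d) × ℝ => ((p.1.1 + p.2 • (p.1.2 : Space d), p.1.2), p.2))
      (((volume : Measure (Space d)).prod (sphereMeasure d)).prod ν)
      (((volume : Measure (Space d)).prod (sphereMeasure d)).prod ν) := by
  have h := (MeasurePreserving.id ν).skew_product
    (μc := (volume : Measure (Space d)).prod (sphereMeasure d))
    (μd := (volume : Measure (Space d)).prod (sphereMeasure d))
    (g := fun (t : ℝ) (z : Space d × Velocity d) => (z.1 + t • (z.2 : Space d), z.2))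
    (by fun_prop) (ae_of_all _ fun t => (measurePreserving_shift t).map_eq)
  exact (Measure.measurePreserving_swap.comp h).comp Measure.measurePreserving_swap

/-! ### Bounded representatives -/

/-- Clamping at the essential supremum and cutting off outside `Ω` gives coefficients defined at
every point, so that the equation can be integrated along entire lines. -/
theorem exists_bounded_representative {β : Type*} [MeasurableSpace β] {ν : Measure β} [SFinite ν]
    {Ω : Set (Space d)} (hΩ : MeasurableSet Ω) {p : Space d × β → ℝ}
    (hp : MemLp p ⊤ ((volume.restrict Ω).prod ν)) :
    ∃ (p' : Space d × β → ℝ) (M : ℝ), Measurable p' ∧ 0 ≤ M ∧ (∀ z, |p' z| ≤ M) ∧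
      (∀ z, z.1 ∉ Ω → p' z = 0) ∧ p =ᵐ[(volume.restrict Ω).prod ν] p' := by
  obtain ⟨hm, hb⟩ := hp
  rw [eLpNorm_exponent_top] at hb
  set M := (eLpNormEssSup p ((volume.restrict Ω).prod ν)).toReal
  set g := hm.aemeasurable.mk p
  have hg : Measurable g := hm.aemeasurable.measurable_mk
  have hpg : p =ᵐ[_] g := hm.aemeasurable.ae_eq_mk
  have hM : 0 ≤ M := ENNReal.toReal_nonneg
  refine ⟨(Prod.fst ⁻¹' Ω).indicator fun z => max (-M) (min M (g z)), M, ?_, hM, ?_, ?_, ?_⟩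
  · exact ((measurable_const.max (measurable_const.min hg))).indicator (measurable_fst hΩ)
  · intro z
    by_cases h : z ∈ (Prod.fst ⁻¹' Ω : Set (Space d × β))
    · rw [indicator_of_mem h, abs_le]
      exact ⟨le_max_left _ _, max_le (by linarith) (min_le_left _ _)⟩
    · rw [indicator_of_notMem h]; simpa
  · intro z hz
    exact indicator_of_notMem (s := Prod.fst ⁻¹' Ω) hz _
  · have hmem : ∀ᵐ z ∂((volume.restrict Ω).prod ν), z.1 ∈ Ω :=
      Measure.quasiMeasurePreserving_fst.ae (ae_restrict_mem hΩ)
    filter_upwards [hpg, hmem, enorm_ae_le_eLpNormEssSup p ((volume.restrict Ω).prod ν)]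
      with z h1 h2 h3
    rw [indicator_of_mem (s := Prod.fst ⁻¹' Ω) h2, ← h1]
    have : |p z| ≤ M := by
      have := ENNReal.toReal_mono hb.ne h3
      simpa using this
    rw [abs_le] at this
    rw [min_eq_right this.2, max_eq_right this.1]

end NonlinearTransport

namespace NonlinearTransport

/-! ### Picard iteration for integral equations along characteristics -/

/-- `G` acts at each time separately and is Lipschitz with constant `L` for the norm weighted
by `W`. -/
structure IsCausalLipschitz {X : Type*} [MeasurableSpace X] (W : X → ℝ) (L : ℝ)
    (G : (X × ℝ → ℝ) → X × ℝ → ℝ) : Prop where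
  measurable : ∀ F, Measurable F → Measurable (G F)
  zero : ∀ p, G (fun _ => 0) p = 0
  -- The bound `m'` does not enter the estimate; it only guarantees that the integrals hidden in `G`
  -- converge and may be subtracted.
  lipschitz : ∀ F F', Measurable F → Measurable F' → ∀ s m m', 0 ≤ m →
    (∀ x, |F (x, s)| ≤ m') → (∀ x, |F' (x, s)| ≤ m') →
    (∀ x, |F (x, s) - F' (x, s)| ≤ m * W x) →
    ∀ x, |G F (x, s) - G F' (x, s)| ≤ L * (m * W x)

variable {X : Type*} [MeasurableSpace X] {W h : X → ℝ} {L : ℝ} {G : (X × ℝ → ℝ) → X × ℝ → ℝ}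

/-- The Picard operator of the equation `F(x, t) = h(x) + ∫₀ᵗ G(F)(x, s) ds`. -/
noncomputable def picard (G : (X × ℝ → ℝ) → X × ℝ → ℝ) (h : X → ℝ) (F : X × ℝ → ℝ) (p : X × ℝ) :
    ℝ :=
  h p.1 + ∫ s in Ioc 0 p.2, G F (p.1, s)

theorem measurable_picard (hh : Measurable h) {F : X × ℝ → ℝ} (hF : Measurable (G F)) :
    Measurable (picard G h F) := by
  refine (hh.comp measurable_fst).add ?_
  have hs : MeasurableSet {p : (X × ℝ) × ℝ | 0 < p.2 ∧ p.2 ≤ p.1.2} :=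
    (measurableSet_lt measurable_const measurable_snd).inter
      (measurableSet_le measurable_snd (measurable_snd.comp measurable_fst))
  have hm : Measurable ({p : (X × ℝ) × ℝ | 0 < p.2 ∧ p.2 ≤ p.1.2}.indicator
      fun p => G F (p.1.1, p.2)) :=
    (hF.comp ((measurable_fst.comp measurable_fst).prodMk measurable_snd)).indicator hs
  have := hm.stronglyMeasurable.integral_prod_right' (ν := (volume : Measure ℝ))
  convert this.measurable using 2 with p
  rw [← integral_indicator measurableSet_Ioc]
  rfl

theorem IsCausalLipschitz.abs_le (hG : IsCausalLipschitz W L G) {F : X × ℝ → ℝ}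
    (hF : Measurable F) {W₀ : ℝ} (hW : ∀ x, 0 ≤ W x) (hW₀ : ∀ x, W x ≤ W₀) {s m : ℝ}
    (hm : 0 ≤ m) (hb : ∀ x, |F (x, s)| ≤ m * W x) (x : X) : |G F (x, s)| ≤ L * (m * W x) := by
  have := hG.lipschitz F (fun _ => 0) hF measurable_const s m (m * W₀) hm
    (fun x => (hb x).trans (by gcongr; exact hW₀ x))
    (fun x => by simpa using mul_nonneg hm ((hW x).trans (hW₀ x))) (by simpa using hb) x
  rwa [hG.zero, sub_zero] at this

theorem IsCausalLipschitz.integrableOn (hG : IsCausalLipschitz W L G) (hL : 0 < L)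
    {F : X × ℝ → ℝ}
    (hF : Measurable F) {W₀ : ℝ} (hW : ∀ x, 0 ≤ W x) (hW₀ : ∀ x, W x ≤ W₀) {m : ℝ} (hm : 0 ≤ m)
    (hb : ∀ x t, |F (x, t)| ≤ m * Real.exp (2 * L * |t|) * W x) (x : X) (t : ℝ) :
    IntegrableOn (fun s => G F (x, s)) (Ioc 0 t) := by
  refine Measure.integrableOn_of_bounded (M := L * (m * Real.exp (2 * L * t) * W x)) (by simp)
    (((hG.measurable F hF).comp measurable_prodMk_left).aestronglyMeasurable) ?_
  filter_upwards [ae_restrict_mem measurableSet_Ioc] with s hs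
  refine (hG.abs_le hF hW hW₀ (by positivity) (fun x => hb x s) x).trans ?_
  have := hW x
  have : |s| ≤ t := by rw [abs_of_pos hs.1]; exact hs.2
  gcongr

/-- The factor exp(2L|t|) makes the Picard operator a contraction on every time interval:
integrating L exp(2Ls) from 0 to t gives at most exp(2Lt)/2. -/
theorem IsCausalLipschitz.abs_picard_sub_le (hG : IsCausalLipschitz W L G) (hL : 0 < L)
    {F F' : X × ℝ → ℝ} (hF : Measurable F) (hF' : Measurable F') {W₀ : ℝ}
    (hW : ∀ x, 0 ≤ W x) (hW₀ : ∀ x, W x ≤ W₀) {m : ℝ} (hm : 0 ≤ m)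
    (hb : ∀ x t, |F (x, t)| ≤ m * Real.exp (2 * L * |t|) * W x)
    (hb' : ∀ x t, |F' (x, t)| ≤ m * Real.exp (2 * L * |t|) * W x) {c : ℝ} (hc : 0 ≤ c)
    (hd : ∀ x t, |F (x, t) - F' (x, t)| ≤ c * Real.exp (2 * L * |t|) * W x) (x : X) (t : ℝ) :
    |picard G h F (x, t) - picard G h F' (x, t)| ≤ c / 2 * Real.exp (2 * L * |t|) * W x := by
  have h0 : 0 ≤ c / 2 * Real.exp (2 * L * |t|) * W x := by have := hW x; positivity
  simp only [picard, add_sub_add_left_eq_sub]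
  rcases le_or_gt t 0 with ht | ht
  · simpa [Ioc_eq_empty_of_le ht] using h0
  rw [← integral_sub (hG.integrableOn hL hF hW hW₀ hm hb x t)
    (hG.integrableOn hL hF' hW hW₀ hm hb' x t)]
  have hintegral : ∫ s in (0 : ℝ)..t, L * (c * Real.exp (2 * L * s) * W x) =
      c / 2 * (Real.exp (2 * L * t) - 1) * W x := by
    have : (fun s : ℝ => L * (c * Real.exp (2 * L * s) * W x)) =
        fun s => (L * c * W x) * Real.exp ((2 * L) * s) := by ext s; ring
    have h2L : 2 * L ≠ 0 := by positivity
    rw [this, intervalIntegral.integral_const_mul,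
      intervalIntegral.integral_comp_mul_left (f := Real.exp) h2L, integral_exp]
    simp only [mul_zero, Real.exp_zero, smul_eq_mul]
    field_simp
  have hle : |∫ s in Ioc 0 t, (G F (x, s) - G F' (x, s))| ≤
      ∫ s in Ioc 0 t, L * (c * Real.exp (2 * L * s) * W x) := by
    refine norm_integral_le_of_norm_le (G := ℝ) ?_ ?_
    · exact (by fun_prop : Continuous fun s => L * (c * Real.exp (2 * L * s) * W x)).integrableOn_Ioc
    · filter_upwards [ae_restrict_mem measurableSet_Ioc] with s hs
      have e : |s| = s := abs_of_pos hs.1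
      have hle : ∀ x, m * Real.exp (2 * L * |s|) * W x ≤ m * Real.exp (2 * L * |s|) * W₀ := by
        intro x; gcongr; exact hW₀ x
      have := hG.lipschitz F F' hF hF' s (c * Real.exp (2 * L * |s|))
        (m * Real.exp (2 * L * |s|) * W₀) (by positivity) (fun x => (hb x s).trans (hle x))
        (fun x => (hb' x s).trans (hle x)) (fun x => hd x s) x
      rwa [e] at this
  rw [← intervalIntegral.integral_of_le (f := fun s => L * (c * Real.exp (2 * L * s) * W x)) ht.le,
    hintegral] at hle
  refine hle.trans ?_
  rw [abs_of_pos ht]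
  have := hW x
  gcongr
  linarith

theorem IsCausalLipschitz.exists_solution (hG : IsCausalLipschitz W L G) (hL : 0 < L) {W₀ : ℝ}
    (hW : ∀ x, 0 ≤ W x) (hW₀ : ∀ x, W x ≤ W₀) (hh : Measurable h) (hhW : ∀ x, |h x| ≤ W x) :
    ∃ F : X × ℝ → ℝ, Measurable F ∧ (∀ p, F p = picard G h F p) ∧
      ∀ x t, |F (x, t)| ≤ 2 * Real.exp (2 * L * |t|) * W x := by
  set f : ℕ → X × ℝ → ℝ := fun n => (picard G h)^[n] (fun _ => 0) with hf
  have hsucc : ∀ n, f (n + 1) = picard G h (f n) := fun n => Function.iterate_succ_apply' _ _ _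
  have hone : ∀ (x : X) (t : ℝ), W x ≤ Real.exp (2 * L * |t|) * W x := fun x t =>
    le_mul_of_one_le_left (hW x) (Real.one_le_exp (by positivity))
  have hfirst : ∀ x t, picard G h (fun _ => 0) (x, t) = h x := by
    intro x t
    simp [picard, hG.zero]
  have hbz : ∀ (x : X) (t : ℝ), |(fun _ => 0 : X × ℝ → ℝ) (x, t)| ≤
      2 * Real.exp (2 * L * |t|) * W x := by
    intro x t
    have := hW x
    simp only [abs_zero]
    positivity
  -- The constant 2 is reproduced: the image of zero is `h`, which costs 1, and the contraction
  -- halves the 2 to the other 1.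
  have hbound : ∀ F : X × ℝ → ℝ, Measurable F →
      (∀ x t, |F (x, t)| ≤ 2 * Real.exp (2 * L * |t|) * W x) →
      ∀ x t, |picard G h F (x, t)| ≤ 2 * Real.exp (2 * L * |t|) * W x := by
    intro F hF hb x t
    have h1 := hG.abs_picard_sub_le (h := h) hL hF measurable_const hW hW₀ zero_le_two hb hbz
      zero_le_two (by simpa using hb) x t
    rw [hfirst] at h1
    have h2 := abs_sub_abs_le_abs_sub (picard G h F (x, t)) (h x)
    have := hone x t
    have := hhW x
    linarith
  have hmb : ∀ n, Measurable (f n) ∧ ∀ x t, |f n (x, t)| ≤ 2 * Real.exp (2 * L * |t|) * W x := by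
    intro n
    induction n with
    | zero => exact ⟨measurable_const, hbz⟩
    | succ n ih =>
      rw [hsucc]
      exact ⟨measurable_picard hh (hG.measurable _ ih.1), hbound _ ih.1 ih.2⟩
  have hdiff : ∀ n x t, |f n (x, t) - f (n + 1) (x, t)| ≤
      1 / 2 ^ n * Real.exp (2 * L * |t|) * W x := by
    intro n
    induction n with
    | zero =>
      intro x t
      have : f 1 (x, t) = h x := by rw [hsucc]; exact hfirst x t
      rw [zero_add, this]
      simpa [hf] using (hhW x).trans (hone x t)
    | succ n ih =>
      intro x t
      rw [hsucc n, hsucc (n + 1)]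
      refine (hG.abs_picard_sub_le hL (hmb n).1 (hmb (n + 1)).1 hW hW₀ zero_le_two (hmb n).2
        (hmb (n + 1)).2 (by positivity) ih x t).trans_eq ?_
      rw [pow_succ]
      ring
  have hdiff' : ∀ p n, dist (f n p) (f (n + 1) p) ≤
      2 * (Real.exp (2 * L * |p.2|) * W p.1) / 2 / 2 ^ n := by
    rintro ⟨x, t⟩ n
    rw [Real.dist_eq]
    refine (hdiff n x t).trans_eq ?_
    field_simp
  have hex : ∀ p, ∃ a, Tendsto (fun n => f n p) atTop (𝓝 a) := fun p =>
    cauchySeq_tendsto_of_complete (cauchySeq_of_le_geometric_two (hdiff' p))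
  choose F hF using hex
  have hFm : Measurable F :=
    measurable_of_tendsto_metrizable (fun n => (hmb n).1) (tendsto_pi_nhds.2 hF)
  have hFb : ∀ x t, |F (x, t)| ≤ 2 * Real.exp (2 * L * |t|) * W x := fun x t =>
    le_of_tendsto (hF (x, t)).abs (Eventually.of_forall fun n => (hmb n).2 x t)
  have hFd : ∀ n x t, |f n (x, t) - F (x, t)| ≤ 2 / 2 ^ n * Real.exp (2 * L * |t|) * W x := by
    intro n x t
    have := dist_le_of_le_geometric_two_of_tendsto (hdiff' (x, t)) (hF (x, t)) n
    rw [Real.dist_eq] at this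
    refine this.trans_eq ?_
    field_simp
  refine ⟨F, hFm, ?_, hFb⟩
  rintro ⟨x, t⟩
  have hlim : Tendsto (fun n => f (n + 1) (x, t)) atTop (𝓝 (picard G h F (x, t))) := by
    rw [tendsto_iff_dist_tendsto_zero]
    have hz : Tendsto (fun n : ℕ => 2 / 2 ^ n / 2 * Real.exp (2 * L * |t|) * W x) atTop (𝓝 0) := by
      have : Tendsto (fun n : ℕ => (1 / 2 : ℝ) ^ n * (Real.exp (2 * L * |t|) * W x)) atTop
          (𝓝 (0 * (Real.exp (2 * L * |t|) * W x))) :=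
        (tendsto_pow_atTop_nhds_zero_of_lt_one (by norm_num) (by norm_num)).mul_const _
      rw [zero_mul] at this
      refine this.congr fun n => ?_
      rw [div_pow, one_pow]
      field_simp
    refine squeeze_zero (fun _ => dist_nonneg) (fun n => ?_) hz
    rw [Real.dist_eq, hsucc]
    exact hG.abs_picard_sub_le hL (hmb n).1 hFm hW hW₀ zero_le_two (hmb n).2 hFb (by positivity)
      (hFd n) x t
  exact tendsto_nhds_unique ((tendsto_add_atTop_iff_nat 1).2 (hF (x, t))) hlim

end NonlinearTransport

namespace NonlinearTransport

theorem IsCausalLipschitz.intervalIntegrable {X : Type*} [MeasurableSpace X] {W : X → ℝ} {L : ℝ}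
    {G : (X × ℝ → ℝ) → X × ℝ → ℝ} (hG : IsCausalLipschitz W L G) {F : X × ℝ → ℝ}
    (hF : Measurable F) {W₀ : ℝ} (hW : ∀ x, 0 ≤ W x) (hW₀ : ∀ x, W x ≤ W₀) {m : ℝ} (hm : 0 ≤ m)
    (hb : ∀ x t, |F (x, t)| ≤ m * Real.exp (2 * L * |t|) * W x) (x : X) (a b : ℝ) :
    IntervalIntegrable (fun s => G F (x, s)) volume a b := by
  have hc : Continuous fun s : ℝ => L * (m * Real.exp (2 * L * |s|) * W x) := by fun_prop
  refine (hc.intervalIntegrable a b).mono_fun'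
    (((hG.measurable F hF).comp measurable_prodMk_left).aestronglyMeasurable)
    (ae_of_all _ fun s => ?_)
  exact hG.abs_le hF hW hW₀ (by positivity) (fun x => hb x s) x

variable {d : ℕ}

/-! ### The collision operator in characteristic coordinates -/

/-- Bounded everywhere defined coefficients, vanishing outside `Ω`, and a globally Lipschitz
nonlinearity. -/
structure IsRegular (Ω : Set (Space d)) (M : ℝ) (σ q : Space d × Velocity d → ℝ)
    (k : Space d × Velocity d × Velocity d → ℝ) (N : ℝ → ℝ) : Prop where
  nonneg : 0 ≤ M
  measurable_σ : Measurable σ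
  measurable_q : Measurable q
  measurable_k : Measurable k
  σ_le : ∀ z, |σ z| ≤ M
  q_le : ∀ z, |q z| ≤ M
  k_le : ∀ z, |k z| ≤ M
  σ_zero : ∀ z, z.1 ∉ Ω → σ z = 0
  q_zero : ∀ z, z.1 ∉ Ω → q z = 0
  k_zero : ∀ z, z.1 ∉ Ω → k z = 0
  lipschitz : ∀ a b, |N a - N b| ≤ M * |a - b|
  N_zero : N 0 = 0

/-- The scattering term in the coordinates `((y, v), t)` standing for `((y + t v, v), t)`. -/
noncomputable def charScattering (k : Space d × Velocity d × Velocity d → ℝ)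
    (F : (Space d × Velocity d) × ℝ → ℝ) (p : (Space d × Velocity d) × ℝ) : ℝ :=
  ∫ v', k (p.1.1 + p.2 • (p.1.2 : Space d), v', p.1.2) *
    F ((p.1.1 + p.2 • (p.1.2 : Space d) - p.2 • (v' : Space d), v'), p.2) ∂(sphereMeasure d)

/-- The right hand side of the transport equation in characteristic coordinates. -/
noncomputable def collision (σ q : Space d × Velocity d → ℝ)
    (k : Space d × Velocity d × Velocity d → ℝ) (N : ℝ → ℝ)
    (F : (Space d × Velocity d) × ℝ → ℝ) (p : (Space d × Velocity d) × ℝ) : ℝ :=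
  -(σ (p.1.1 + p.2 • (p.1.2 : Space d), p.1.2) * F p) -
    q (p.1.1 + p.2 • (p.1.2 : Space d), p.1.2) * N (F p) + charScattering k F p

theorem measurable_charScattering {k : Space d × Velocity d × Velocity d → ℝ} (hk : Measurable k)
    {F : (Space d × Velocity d) × ℝ → ℝ} (hF : Measurable F) :
    Measurable (charScattering k F) := by
  have h : Measurable fun r : ((Space d × Velocity d) × ℝ) × Velocity d =>
      k (r.1.1.1 + r.1.2 • (r.1.1.2 : Space d), r.2, r.1.1.2) *
        F ((r.1.1.1 + r.1.2 • (r.1.1.2 : Space d) - r.1.2 • (r.2 : Space d), r.2), r.1.2) := by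
    refine (hk.comp ?_).mul (hF.comp ?_) <;> fun_prop
  exact (h.stronglyMeasurable.integral_prod_right' (ν := sphereMeasure d)).measurable

variable {Ω : Set (Space d)} {M : ℝ} {σ q : Space d × Velocity d → ℝ}
  {k : Space d × Velocity d × Velocity d → ℝ} {N : ℝ → ℝ}

theorem IsRegular.continuous_N (h : IsRegular Ω M σ q k N) : Continuous N := by
  have : LipschitzWith M.toNNReal N := LipschitzWith.of_dist_le_mul fun a b => by
    rw [Real.coe_toNNReal _ h.nonneg]
    exact h.lipschitz a b
  exact this.continuous

theorem IsRegular.measurable_collision (h : IsRegular Ω M σ q k N)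
    {F : (Space d × Velocity d) × ℝ → ℝ} (hF : Measurable F) :
    Measurable (collision σ q k N F) := by
  have hs : Measurable fun p : (Space d × Velocity d) × ℝ =>
      (p.1.1 + p.2 • (p.1.2 : Space d), p.1.2) := by fun_prop
  exact ((((h.measurable_σ.comp hs).mul hF).neg).sub
    ((h.measurable_q.comp hs).mul (h.continuous_N.measurable.comp hF))).add
      (measurable_charScattering h.measurable_k hF)

/-- Hence solutions are constant along the parts of characteristics outside `Ω`; both the boundary
condition and the reading of the exit trace rest on this. -/
theorem collision_eq_zero (h : IsRegular Ω M σ q k N) (F : (Space d × Velocity d) × ℝ → ℝ)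
    {p : (Space d × Velocity d) × ℝ} (hp : p.1.1 + p.2 • (p.1.2 : Space d) ∉ Ω) :
    collision σ q k N F p = 0 := by
  simp only [collision, charScattering]
  rw [h.σ_zero _ hp, h.q_zero _ hp]
  simp [h.k_zero (p.1.1 + p.2 • (p.1.2 : Space d), _, p.1.2) hp]

theorem integrable_charScattering_kernel (hk : Measurable k) (hkM : ∀ z, |k z| ≤ M)
    {F : (Space d × Velocity d) × ℝ → ℝ} (hF : Measurable F) {s m' : ℝ}
    (hb : ∀ z, |F (z, s)| ≤ m') (x : Space d) (v : Velocity d) :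
    Integrable (fun v' => k (x, v', v) * F ((x - s • (v' : Space d), v'), s))
      (sphereMeasure d) := by
  have hm : Measurable fun v' : Velocity d =>
      k (x, v', v) * F ((x - s • (v' : Space d), v'), s) := by
    refine (hk.comp ?_).mul (hF.comp ?_) <;> fun_prop
  refine Integrable.of_bound hm.aestronglyMeasurable (M * m') (ae_of_all _ fun v' => ?_)
  rw [norm_mul]
  exact mul_le_mul (hkM _) (hb _) (norm_nonneg _) ((abs_nonneg _).trans (hkM (x, v', v)))

theorem abs_charScattering_le (hM : 0 ≤ M) (hkM : ∀ z, |k z| ≤ M) {w : Velocity d → ℝ}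
    (hwi : Integrable w (sphereMeasure d)) {F : (Space d × Velocity d) × ℝ → ℝ} {m : ℝ}
    {p : (Space d × Velocity d) × ℝ} (hb : ∀ z, |F (z, p.2)| ≤ m * w z.2) :
    |charScattering k F p| ≤ M * (m * ∫ v, w v ∂(sphereMeasure d)) := by
  rw [← integral_const_mul, ← integral_const_mul]
  refine norm_integral_le_of_norm_le (G := ℝ) ((hwi.const_mul m).const_mul M) (ae_of_all _ fun v' => ?_)
  rw [norm_mul]
  exact mul_le_mul (hkM _) (hb _) (norm_nonneg _) hM

/-- Scattering sees a bound m·w only through the mean of w, and `hww` turns that mean back into a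
multiple of w. The constant collects M from absorption, M·M from the nonlinearity and 2M from
scattering; the 1 keeps it positive. -/
theorem IsRegular.isCausalLipschitz (h : IsRegular Ω M σ q k N) {w : Velocity d → ℝ}
    (hwi : Integrable w (sphereMeasure d))
    (hww : ∀ v, ∫ v', w v' ∂(sphereMeasure d) ≤ 2 * w v) :
    IsCausalLipschitz (fun z : Space d × Velocity d => w z.2) (3 * M + M * M + 1)
      (collision σ q k N) where
  measurable F hF := h.measurable_collision hF
  zero p := by simp [collision, charScattering, h.N_zero]
  lipschitz F F' hF hF' s m m' hm hb hb' hd z := by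
    have hM := h.nonneg
    set x := z.1 + s • (z.2 : Space d) with hx
    have hsub : charScattering k F (z, s) - charScattering k F' (z, s) =
        charScattering k (fun p => F p - F' p) (z, s) := by
      simp only [charScattering]
      rw [← integral_sub
        (integrable_charScattering_kernel h.measurable_k h.k_le hF hb _ _)
        (integrable_charScattering_kernel h.measurable_k h.k_le hF' hb' _ _)]
      simp only [mul_sub]
    have h1 : |charScattering k F (z, s) - charScattering k F' (z, s)| ≤ M * (m * (2 * w z.2)) := by
      rw [hsub]
      refine (abs_charScattering_le hM h.k_le hwi (m := m) (p := (z, s)) hd).trans ?_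
      have := hww z.2
      gcongr
    have h2 : |σ (x, z.2) * (F (z, s) - F' (z, s))| ≤ M * (m * w z.2) := by
      rw [abs_mul]
      exact mul_le_mul (h.σ_le _) (hd z) (abs_nonneg _) hM
    have h3 : |q (x, z.2) * (N (F (z, s)) - N (F' (z, s)))| ≤ M * (M * (m * w z.2)) := by
      rw [abs_mul]
      exact mul_le_mul (h.q_le _) ((h.lipschitz _ _).trans (by gcongr; exact hd z))
        (abs_nonneg _) hM
    have h4 : 0 ≤ m * w z.2 := (abs_nonneg _).trans (hd z)
    have heq : collision σ q k N F (z, s) - collision σ q k N F' (z, s) =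
        -(σ (x, z.2) * (F (z, s) - F' (z, s))) -
          q (x, z.2) * (N (F (z, s)) - N (F' (z, s))) +
          (charScattering k F (z, s) - charScattering k F' (z, s)) := by
      simp only [collision, hx]
      ring
    rw [heq]
    refine (abs_add_le _ _).trans ?_
    have h5 := abs_sub (-(σ (x, z.2) * (F (z, s) - F' (z, s))))
      (q (x, z.2) * (N (F (z, s)) - N (F' (z, s))))
    rw [abs_neg] at h5
    nlinarith

/-- `F` solves the transport equation with initial value `h` on the whole space, written in
characteristic coordinates. -/
structure IsCharSolution (σ q : Space d × Velocity d → ℝ)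
    (k : Space d × Velocity d × Velocity d → ℝ) (N : ℝ → ℝ) (h : Space d × Velocity d → ℝ)
    (F : (Space d × Velocity d) × ℝ → ℝ) : Prop where
  measurable : Measurable F
  intervalIntegrable : ∀ z a b, IntervalIntegrable (fun s => collision σ q k N F (z, s)) volume a b
  eq_add_integral : ∀ z t, 0 ≤ t → F (z, t) = h z + ∫ s in 0..t, collision σ q k N F (z, s)
  continuous : ∀ z, Continuous fun t => F (z, t)

theorem IsRegular.exists_isCharSolution (hr : IsRegular Ω M σ q k N) {w : Velocity d → ℝ}
    (hwm : Measurable w) {W₀ : ℝ} (hw : ∀ v, 0 ≤ w v) (hw₀ : ∀ v, w v ≤ W₀)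
    (hww : ∀ v, ∫ v', w v' ∂(sphereMeasure d) ≤ 2 * w v)
    {h : Space d × Velocity d → ℝ} (hh : Measurable h) (hhw : ∀ z, |h z| ≤ w z.2) :
    ∃ F, IsCharSolution σ q k N h F ∧
      ∀ z t, |F (z, t)| ≤ 2 * Real.exp (2 * (3 * M + M * M + 1) * |t|) * w z.2 := by
  have hM := hr.nonneg
  have hwi : Integrable w (sphereMeasure d) :=
    Integrable.of_bound hwm.aestronglyMeasurable W₀
      (ae_of_all _ fun v => by rw [Real.norm_eq_abs, abs_of_nonneg (hw v)]; exact hw₀ v)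
  have hL : 0 < 3 * M + M * M + 1 := by positivity
  have hG := hr.isCausalLipschitz hwi hww
  obtain ⟨F, hF, hP, hb⟩ := hG.exists_solution (h := h) hL (fun z => hw z.2) (fun z => hw₀ z.2)
    hh hhw
  have hii := hG.intervalIntegrable hF (fun z => hw z.2) (fun z => hw₀ z.2) zero_le_two hb
  refine ⟨F, ⟨hF, hii, fun z t ht => ?_, fun z => ?_⟩, hb⟩
  · rw [hP, picard, intervalIntegral.integral_of_le ht]
  -- The Picard integral runs over `Ioc 0 t`, which is empty for t ≤ 0, so F equals its initial
  -- value at negative times.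
  · have : (fun t => F (z, t)) =
        fun t => h z + ∫ s in 0..(max t 0), collision σ q k N F (z, s) := by
      ext t
      rw [hP, picard, intervalIntegral.integral_of_le (le_max_right _ _)]
      rcases le_total t 0 with ht | ht
      · simp [ht]
      · simp [ht]
    rw [this]
    exact continuous_const.add ((intervalIntegral.continuous_primitive (hii z) 0).comp
      (continuous_id.max continuous_const))

end NonlinearTransport

namespace NonlinearTransport

/-! ### Calculus of primitives -/

/-- The product rule for absolutely continuous functions. Derivatives exist only almost everywhere
because the coefficients are merely measurable along rays. -/
theorem integral_mul_add_mul_eq_sub {u w U W : ℝ → ℝ} {T : ℝ} (hT : 0 ≤ T)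
    (hu : IntervalIntegrable u volume 0 T) (hw : IntervalIntegrable w volume 0 T)
    (hU : ∀ t ∈ Icc 0 T, U t = U 0 + ∫ s in 0..t, u s)
    (hW : ∀ t ∈ Icc 0 T, W t = W 0 + ∫ s in 0..t, w s) :
    ∫ t in 0..T, (u t * W t + U t * w t) = U T * W T - U 0 * W 0 := by
  have h0 : (0 : ℝ) ∈ uIcc 0 T := by simp
  have hc : ∀ c : ℝ, AbsolutelyContinuousOnInterval (fun _ => c) 0 T := fun c =>
    (LipschitzWith.const c).lipschitzOnWith.absolutelyContinuousOnInterval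
  have h := ((hc (U 0)).fun_add
    (hu.absolutelyContinuousOnInterval_intervalIntegral h0)).integral_deriv_mul_eq_sub
    ((hc (W 0)).fun_add (hw.absolutelyContinuousOnInterval_intervalIntegral h0))
  rw [← hU T ⟨hT, le_rfl⟩, ← hW T ⟨hT, le_rfl⟩] at h
  simp only [intervalIntegral.integral_same, add_zero] at h
  rw [← h]
  refine intervalIntegral.integral_congr_ae ?_
  filter_upwards [hu.ae_hasDerivAt_integral, hw.ae_hasDerivAt_integral] with t h1 h2 ht
  have ht' : t ∈ uIcc 0 T := uIoc_subset_uIcc ht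
  have ht'' : t ∈ Icc 0 T := by rwa [uIcc_of_le hT] at ht'
  rw [((h1 ht' 0 h0).const_add (U 0)).deriv, ((h2 ht' 0 h0).const_add (W 0)).deriv,
    ← hU t ht'', ← hW t ht'']

theorem exp_integral_eq {u : ℝ → ℝ} {M T : ℝ} (hM : 0 ≤ M) (hum : Measurable u)
    (hu : ∀ t, |u t| ≤ M) (hT : 0 ≤ T) :
    Real.exp (∫ s in 0..T, u s) = 1 + ∫ t in 0..T, u t * Real.exp (∫ s in 0..t, u s) := by
  have hui : ∀ a b, IntervalIntegrable u volume a b := fun a b =>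
    (intervalIntegrable_const (c := M)).mono_fun' hum.aestronglyMeasurable (ae_of_all _ hu)
  have hun : ∀ t, ‖u t‖ ≤ M := hu
  have hlip : LipschitzWith M.toNNReal fun t => ∫ s in 0..t, u s := by
    refine LipschitzWith.of_dist_le_mul fun a b => ?_
    rw [Real.coe_toNNReal _ hM, Real.dist_eq, Real.dist_eq,
      intervalIntegral.integral_interval_sub_left (hui _ _) (hui _ _)]
    exact intervalIntegral.norm_integral_le_of_norm_le_const fun t _ => hun t
  -- The exponential is Lipschitz only on bounded sets, and the primitive stays in [-MT, MT]; the
  -- composite is then Lipschitz, hence absolutely continuous.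
  obtain ⟨K, hK⟩ := (Real.contDiff_exp (n := 1)).contDiffOn.exists_lipschitzOnWith one_ne_zero
    (convex_Icc (-(M * T)) (M * T)) isCompact_Icc
  have hmap : MapsTo (fun t => ∫ s in 0..t, u s) (uIcc 0 T) (Icc (-(M * T)) (M * T)) := by
    intro t ht
    rw [uIcc_of_le hT] at ht
    have := intervalIntegral.norm_integral_le_of_norm_le_const (a := 0) (b := t) fun t _ => hun t
    rw [sub_zero, abs_of_nonneg ht.1, Real.norm_eq_abs] at this
    exact abs_le.1 (this.trans (by gcongr; exact ht.2))
  have hac : AbsolutelyContinuousOnInterval (fun t => Real.exp (∫ s in 0..t, u s)) 0 T :=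
    (hK.comp hlip.lipschitzOnWith hmap).absolutelyContinuousOnInterval
  have h := hac.integral_deriv_eq_sub
  simp only [intervalIntegral.integral_same, Real.exp_zero] at h
  rw [eq_add_of_sub_eq' h.symm]
  congr 1
  refine intervalIntegral.integral_congr_ae ?_
  filter_upwards [(hui 0 T).ae_hasDerivAt_integral] with t h1 ht
  rw [(h1 (uIoc_subset_uIcc ht) 0 (by simp)).exp.deriv, mul_comm]

/-- Duhamel's formula for `U' = -σ U + g`. -/
theorem mul_exp_integral_eq {σ g U : ℝ → ℝ} {M T : ℝ} (hM : 0 ≤ M) (hσm : Measurable σ)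
    (hσ : ∀ t, |σ t| ≤ M) (hT : 0 ≤ T) (hUc : Continuous U)
    (hg : IntervalIntegrable g volume 0 T)
    (hU : ∀ t ∈ Icc 0 T, U t = U 0 + ∫ s in 0..t, (-(σ s * U s) + g s)) :
    U T * Real.exp (∫ s in 0..T, σ s) =
      U 0 + ∫ t in 0..T, g t * Real.exp (∫ s in 0..t, σ s) := by
  have hσi : ∀ a b, IntervalIntegrable σ volume a b := fun a b =>
    (intervalIntegrable_const (c := M)).mono_fun' hσm.aestronglyMeasurable (ae_of_all _ hσ)
  have hec : Continuous fun t => Real.exp (∫ s in 0..t, σ s) :=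
    (intervalIntegral.continuous_primitive hσi 0).rexp
  have h := integral_mul_add_mul_eq_sub (W := fun t => Real.exp (∫ s in 0..t, σ s)) hT
    (((hσi 0 T).mul_continuousOn hUc.continuousOn).neg.add hg)
    ((hσi 0 T).mul_continuousOn hec.continuousOn) hU
    (fun t ht => by simpa using exp_integral_eq hM hσm hσ ht.1)
  simp only [intervalIntegral.integral_same, Real.exp_zero, mul_one] at h
  rw [← sub_eq_iff_eq_add', ← h]
  refine intervalIntegral.integral_congr fun t _ => ?_
  simp only [Pi.neg_apply]
  ring

end NonlinearTransport

namespace NonlinearTransport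

variable {d : ℕ}

/-! ### From characteristic coordinates to solutions in the sense of distributions -/

/-- The function `f(t, x, v) = F(t, x - t v, v)`. -/
noncomputable def physical (F : (Space d × Velocity d) × ℝ → ℝ) (p : (Space d × Velocity d) × ℝ) :
    ℝ :=
  F ((p.1.1 - p.2 • (p.1.2 : Space d), p.1.2), p.2)

theorem measurable_physical {F : (Space d × Velocity d) × ℝ → ℝ} (hF : Measurable F) :
    Measurable (physical F) :=
  hF.comp (by fun_prop)

theorem scattering_physical (k : Space d × Velocity d × Velocity d → ℝ)
    (F : (Space d × Velocity d) × ℝ → ℝ) (p : (Space d × Velocity d) × ℝ) :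
    scattering k (physical F) p = physical (charScattering k F) p := by
  simp [scattering, physical, charScattering]

theorem physical_collision (σ q : Space d × Velocity d → ℝ)
    (k : Space d × Velocity d × Velocity d → ℝ) (N : ℝ → ℝ)
    (F : (Space d × Velocity d) × ℝ → ℝ) (p : (Space d × Velocity d) × ℝ) :
    physical (collision σ q k N F) p =
      -(σ p.1 * physical F p + q p.1 * N (physical F p) - scattering k (physical F) p) := by
  rw [scattering_physical]
  simp only [physical, collision, sub_add_cancel]
  ring

theorem phaseTimeMeasure_eq_restrict (Ω : Set (Space d)) (T : ℝ) :
    phaseTimeMeasure Ω T = (((volume : Measure (Space d)).prod (sphereMeasure d)).prod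
      (volume.restrict (Ioo 0 T))).restrict {p | p.1.1 ∈ Ω} := by
  have h : {p : (Space d × Velocity d) × ℝ | p.1.1 ∈ Ω} = (Ω ×ˢ univ) ×ˢ univ := by
    ext p; simp
  rw [phaseTimeMeasure, phaseMeasure, h, ← Measure.prod_restrict, ← Measure.prod_restrict,
    Measure.restrict_univ, Measure.restrict_univ]

theorem isFiniteMeasure_phaseMeasure {Ω : Set (Space d)} (hΩ : Bornology.IsBounded Ω) :
    IsFiniteMeasure (phaseMeasure Ω) := by
  have : IsFiniteMeasure ((volume : Measure (Space d)).restrict Ω) :=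
    ⟨by rw [Measure.restrict_apply_univ]; exact hΩ.measure_lt_top⟩
  rw [phaseMeasure]
  infer_instance

theorem isFiniteMeasure_phaseTimeMeasure {Ω : Set (Space d)} (hΩ : Bornology.IsBounded Ω) (T : ℝ) :
    IsFiniteMeasure (phaseTimeMeasure Ω T) := by
  have := isFiniteMeasure_phaseMeasure hΩ
  rw [phaseTimeMeasure]
  infer_instance

variable {Ω : Set (Space d)} {M T : ℝ} {σ q : Space d × Velocity d → ℝ}
  {k : Space d × Velocity d × Velocity d → ℝ} {N : ℝ → ℝ} {h : Space d × Velocity d → ℝ}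
  {F : (Space d × Velocity d) × ℝ → ℝ}

theorem abs_collision_le (hr : IsRegular Ω M σ q k N) (hd : 2 ≤ d) {s m : ℝ}
    (hb : ∀ z, |F (z, s)| ≤ m) (z : Space d × Velocity d) :
    |collision σ q k N F (z, s)| ≤ (2 * M + M * M) * m := by
  have hM := hr.nonneg
  have := isProbabilityMeasure_sphereMeasure hd
  have h1 := abs_charScattering_le hM hr.k_le (w := fun _ => (1 : ℝ)) (integrable_const _)
    (F := F) (m := m) (p := (z, s)) (by simpa using hb)
  simp only [integral_const, probReal_univ, smul_eq_mul, mul_one] at h1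
  have h2 : |σ (z.1 + s • (z.2 : Space d), z.2) * F (z, s)| ≤ M * m := by
    rw [abs_mul]
    exact mul_le_mul (hr.σ_le _) (hb z) (abs_nonneg _) hM
  have h3 : |q (z.1 + s • (z.2 : Space d), z.2) * N (F (z, s))| ≤ M * (M * m) := by
    rw [abs_mul]
    refine mul_le_mul (hr.q_le _) ?_ (abs_nonneg _) hM
    have := hr.lipschitz (F (z, s)) 0
    rw [hr.N_zero, sub_zero, sub_zero] at this
    exact this.trans (by gcongr; exact hb z)
  rw [collision]
  refine (abs_add_le _ _).trans ?_
  have h5 := abs_sub (-(σ (z.1 + s • (z.2 : Space d), z.2) * F (z, s)))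
    (q (z.1 + s • (z.2 : Space d), z.2) * N (F (z, s)))
  rw [abs_neg] at h5
  linarith

theorem hasDerivAt_along_characteristic {φ : (Space d × Space d) × ℝ → ℝ} (hφ : ContDiff ℝ ∞ φ)
    (y v : Space d) (t : ℝ) :
    HasDerivAt (fun t : ℝ => φ ((y + t • v, v), t))
      (fderiv ℝ φ ((y + t • v, v), t) ((v, 0), 1)) t := by
  have h1 : HasDerivAt (fun t : ℝ => (((y + t • v, v), t) : (Space d × Space d) × ℝ))
      ((v, 0), 1) t := by
    refine HasDerivAt.prodMk (HasDerivAt.prodMk ?_ (hasDerivAt_const _ _)) (hasDerivAt_id t)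
    simpa using ((hasDerivAt_id t).smul_const v).const_add y
  exact ((hφ.differentiable (by simp)).differentiableAt.hasFDerivAt).comp_hasDerivAt t h1

/-- The shear (y, v, t) ↦ (y + tv, v, t) preserves measure and turns the tested equation, on each
characteristic, into the integral of the derivative of F·φ. That integral vanishes because φ is zero
at times 0 and T. -/
theorem isWeakSolution_physical (hr : IsRegular Ω M σ q k N) (hd : 2 ≤ d)
    (hΩ : MeasurableSet Ω) (hΩb : Bornology.IsBounded Ω) (hT : 0 ≤ T)
    (hF : IsCharSolution σ q k N h F) {m : ℝ} (hm : 0 ≤ m)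
    (hb : ∀ z, ∀ t ∈ Icc 0 T, |F (z, t)| ≤ m) :
    IsWeakSolution Ω T σ k (fun z y => q z * N y) (physical F) := by
  intro φ hφ hφc hφs
  have hfin := isFiniteMeasure_phaseTimeMeasure hΩb T
  set C := collision σ q k N F with hC
  have hCm : Measurable C := hr.measurable_collision hF.measurable
  set j : (Space d × Velocity d) × ℝ → (Space d × Space d) × ℝ :=
    fun p => ((p.1.1, (p.1.2 : Space d)), p.2) with hj
  have hjc : Continuous j := by fun_prop
  set Dφ : (Space d × Velocity d) × ℝ → ℝ :=
    fun p => fderiv ℝ φ (j p) (((p.1.2 : Space d), 0), 1) with hDφ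
  have hDc : Continuous Dφ := by
    have := (hφ.continuous_fderiv (by simp)).comp hjc
    exact this.clm_apply (by fun_prop)
  obtain ⟨b₁, hb₁⟩ := hφc.exists_bound_of_continuous hφ.continuous
  obtain ⟨b₂, hb₂⟩ := (hφc.fderiv ℝ).exists_bound_of_continuous (hφ.continuous_fderiv (by simp))
  have hφ0 : ∀ p : (Space d × Velocity d) × ℝ, ¬ (p.1.1 ∈ Ω ∧ p.2 ∈ Ioo 0 T) → φ (j p) = 0 :=
    fun p hp => image_eq_zero_of_notMem_tsupport fun h => hp (hφs h)
  have hD0 : ∀ p : (Space d × Velocity d) × ℝ, ¬ (p.1.1 ∈ Ω ∧ p.2 ∈ Ioo 0 T) → Dφ p = 0 := by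
    intro p hp
    have : fderiv ℝ φ (j p) = 0 :=
      image_eq_zero_of_notMem_tsupport fun h => hp (hφs (tsupport_fderiv_subset ℝ h))
    simp [hDφ, this]
  have htime : ∀ᵐ p ∂(phaseTimeMeasure Ω T), p.2 ∈ Ioo 0 T :=
    Measure.quasiMeasurePreserving_snd.ae (ae_restrict_mem measurableSet_Ioo)
  have hi₁ : Integrable (fun p => physical F p * Dφ p) (phaseTimeMeasure Ω T) := by
    refine Integrable.of_bound ((measurable_physical hF.measurable).mul
      hDc.measurable).aestronglyMeasurable (m * (b₂ * 1)) ?_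
    filter_upwards [htime] with p hp
    rw [norm_mul]
    refine mul_le_mul (hb _ _ ⟨hp.1.le, hp.2.le⟩) ?_ (norm_nonneg _) hm
    refine (ContinuousLinearMap.le_opNorm _ _).trans ?_
    refine mul_le_mul (hb₂ _) ?_ (norm_nonneg _) ((norm_nonneg _).trans (hb₂ (j p)))
    simp [Prod.norm_def]
  have hi₂ : Integrable (fun p => physical C p * φ (j p)) (phaseTimeMeasure Ω T) := by
    refine Integrable.of_bound ((measurable_physical hCm).mul
      (hφ.continuous.comp hjc).measurable).aestronglyMeasurable ((2 * M + M * M) * m * b₁) ?_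
    filter_upwards [htime] with p hp
    rw [norm_mul]
    have hM := hr.nonneg
    exact mul_le_mul (abs_collision_le hr hd (fun z => hb z _ ⟨hp.1.le, hp.2.le⟩) _) (hb₁ _)
      (norm_nonneg _) (by positivity)
  set ν := ((volume : Measure (Space d)).prod (sphereMeasure d)).prod
    ((volume : Measure ℝ).restrict (Ioo 0 T)) with hν
  set A : (Space d × Velocity d) × ℝ → ℝ :=
    fun p => physical F p * Dφ p + physical C p * φ (j p) with hA
  -- The test function vanishes off `Ω`, so the integral may be taken over all of space, where the
  -- shear acts.
  have hA0 : ∀ p, p ∉ {p : (Space d × Velocity d) × ℝ | p.1.1 ∈ Ω} → A p = 0 := by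
    intro p hp
    have : ¬ (p.1.1 ∈ Ω ∧ p.2 ∈ Ioo 0 T) := fun h => hp h.1
    simp only [hA, hD0 p this, hφ0 p this, mul_zero, add_zero]
  have hmeasΩ : MeasurableSet {p : (Space d × Velocity d) × ℝ | p.1.1 ∈ Ω} :=
    (measurable_fst.comp measurable_fst) hΩ
  have hAi : Integrable A ν := by
    have : IntegrableOn A {p | p.1.1 ∈ Ω} ν := by
      rw [IntegrableOn, ← phaseTimeMeasure_eq_restrict]
      exact hi₁.add hi₂
    rwa [integrableOn_iff_integrable_of_support_subset] at this
    intro p hp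
    by_contra hp'
    exact hp (hA0 p hp')
  have hshear := measurePreserving_shear (d := d) ((volume : Measure ℝ).restrict (Ioo 0 T))
  have hAS := hshear.integrable_comp_of_integrable hAi
  have hzero : ∫ p, A p ∂(phaseTimeMeasure Ω T) = 0 := by
    rw [phaseTimeMeasure_eq_restrict, setIntegral_eq_integral_of_forall_compl_eq_zero hA0,
      ← hshear.map_eq, integral_map hshear.measurable.aemeasurable
        (by rw [hshear.map_eq]; exact hAi.aestronglyMeasurable)]
    refine (integral_prod _ hAS).trans ?_
    refine integral_eq_zero_of_ae (ae_of_all _ fun z => ?_)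
    simp only [Pi.zero_apply, Function.comp_apply]
    rw [← integral_Ioc_eq_integral_Ioo, ← intervalIntegral.integral_of_le hT]
    set Φ : ℝ → ℝ := fun t => φ ((z.1 + t • (z.2 : Space d), (z.2 : Space d)), t) with hΦ
    set Φ' : ℝ → ℝ := fun t => Dφ ((z.1 + t • (z.2 : Space d), z.2), t) with hΦ'
    have hΦ'c : Continuous Φ' := hDc.comp (by fun_prop)
    have hend : ∀ t, t ∉ Ioo 0 T → Φ t = 0 := fun t ht =>
      hφ0 ((z.1 + t • (z.2 : Space d), z.2), t) fun h => ht h.2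
    have hprod := integral_mul_add_mul_eq_sub (U := fun t => F (z, t)) (W := Φ) hT
      (hF.intervalIntegrable z 0 T) (hΦ'c.intervalIntegrable 0 T)
      (fun t ht => by simp [hF.eq_add_integral z t ht.1, hF.eq_add_integral z 0 le_rfl])
      (fun t _ => by
        rw [intervalIntegral.integral_eq_sub_of_hasDerivAt
          (fun s _ => hasDerivAt_along_characteristic hφ z.1 z.2 s)
          (hΦ'c.intervalIntegrable 0 t)]
        simp [hΦ])
    rw [hend T (by simp), hend 0 (by simp), mul_zero, mul_zero, sub_zero] at hprod
    refine (intervalIntegral.integral_congr fun t _ => ?_).trans hprod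
    simp only [hA, physical, add_sub_cancel_right, hΦ, hΦ', hj, hC]
    ring
  rw [integral_add hi₁ hi₂] at hzero
  rw [eq_neg_of_add_eq_zero_left hzero, ← integral_neg]
  refine integral_congr_ae (ae_of_all _ fun p => ?_)
  simp only [hC, physical_collision, hj]
  ring

end NonlinearTransport

namespace NonlinearTransport

variable {d : ℕ} {Ω : Set (Space d)}

/-! ### Geometry of the boundary -/

/-- The open segment from x to y lies in `Ω`, so ρ is negative on it near x while ρ(x) ≥ 0; the
one-sided derivative of ρ at x, which is c⟨n, y - x⟩, cannot be positive. -/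
theorem IsOuterNormal.inner_sub_nonpos (hΩ : IsOpen Ω) (hc : Convex ℝ Ω) {x n : Space d}
    (hx : x ∈ frontier Ω) (hn : IsOuterNormal Ω x n) {y : Space d} (hy : y ∈ Ω) :
    inner ℝ n (y - x) ≤ 0 := by
  obtain ⟨-, U, ρ, c, hU, hxU, -, hρ, hc0, hg⟩ := hn
  have hxΩ : x ∉ Ω := fun h => (hΩ.inter_frontier_eq ▸ (⟨h, hx⟩ : x ∈ Ω ∩ frontier Ω) : x ∈ (∅ : Set _))
  have hρx : 0 ≤ ρ x := not_lt.1 fun h => hxΩ ((hρ x hxU).2 h)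
  have hline : HasDerivAt (fun s : ℝ => x + s • (y - x)) (y - x) 0 := by
    simpa using ((hasDerivAt_id (0 : ℝ)).smul_const (y - x)).const_add x
  have hg' : HasFDerivAt ρ (InnerProductSpace.toDual ℝ (Space d) (c • n)) (x + (0 : ℝ) • (y - x)) := by
    simpa using hg.hasFDerivAt
  have hd := hg'.comp_hasDerivAt (0 : ℝ) hline
  simp only [InnerProductSpace.toDual_apply_apply, inner_smul_left, conj_trivial] at hd
  have hlim := hd.hasDerivWithinAt (s := Ioi 0)
  rw [hasDerivWithinAt_iff_tendsto_slope' (by simp)] at hlim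
  have hmem : ∀ᶠ s : ℝ in 𝓝[>] 0, x + s • (y - x) ∈ U ∧ x + s • (y - x) ∈ Ω := by
    have h1 : ∀ᶠ s : ℝ in 𝓝 0, x + s • (y - x) ∈ U := by
      refine hline.continuousAt.eventually_mem (hU.mem_nhds ?_)
      simpa using hxU
    filter_upwards [nhdsWithin_le_nhds h1, Ioo_mem_nhdsGT one_pos] with s hs hs'
    refine ⟨hs, ?_⟩
    have := hc.add_smul_sub_mem_interior' hx.1 (hΩ.interior_eq.symm ▸ hy) ⟨hs'.1, hs'.2.le⟩
    rwa [hΩ.interior_eq] at this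
  have : c * inner ℝ n (y - x) ≤ 0 := by
    refine le_of_tendsto hlim ?_
    filter_upwards [hmem, self_mem_nhdsWithin] with s hs hs0
    rw [slope_def_field]
    refine div_nonpos_of_nonpos_of_nonneg ?_ (by simpa using (mem_Ioi.1 hs0).le)
    have := (hρ _ hs.1).1 hs.2
    simp only [Function.comp_apply, zero_smul, add_zero]
    linarith
  exact nonpos_of_mul_nonpos_right this hc0

/-- Openness leaves room to move y a little in the direction n before applying the weak inequality.
-/
theorem IsOuterNormal.inner_sub_neg (hΩ : IsOpen Ω) (hc : Convex ℝ Ω) {x n : Space d}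
    (hx : x ∈ frontier Ω) (hn : IsOuterNormal Ω x n) {y : Space d} (hy : y ∈ Ω) :
    inner ℝ n (y - x) < 0 := by
  obtain ⟨ε, hε, hball⟩ := Metric.isOpen_iff.1 hΩ y hy
  have hmem : y + (ε / 2) • n ∈ Ω := by
    refine hball ?_
    rw [Metric.mem_ball, dist_eq_norm, add_sub_cancel_left, norm_smul, hn.1, mul_one,
      Real.norm_eq_abs, abs_of_pos (by positivity)]
    linarith
  have h := hn.inner_sub_nonpos hΩ hc hx hmem
  rw [add_sub_right_comm, inner_add_right, inner_smul_right, real_inner_self_eq_norm_sq, hn.1] at h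
  linarith

theorem sub_smul_notMem_of_incoming (hΩ : IsOpen Ω) (hc : Convex ℝ Ω) {x : Space d} {v : Velocity d}
    (h : (x, v) ∈ incoming Ω) {r : ℝ} (hr : 0 ≤ r) : x - r • (v : Space d) ∉ Ω := by
  obtain ⟨hx, n, hn, hv⟩ := h
  intro hmem
  have := hn.inner_sub_neg hΩ hc hx hmem
  rw [sub_sub_cancel_left, inner_neg_right, inner_smul_right] at this
  nlinarith

theorem add_smul_notMem_of_outgoing (hΩ : IsOpen Ω) (hc : Convex ℝ Ω) {x : Space d} {v : Velocity d}
    (h : (x, v) ∈ outgoing Ω) {r : ℝ} (hr : 0 ≤ r) : x + r • (v : Space d) ∉ Ω := by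
  obtain ⟨hx, n, hn, hv⟩ := h
  intro hmem
  have := hn.inner_sub_neg hΩ hc hx hmem
  rw [add_sub_cancel_left, inner_smul_right] at this
  simp only at hv
  nlinarith

theorem norm_velocity (v : Velocity d) : ‖(v : Space d)‖ = 1 := norm_eq_of_mem_sphere v

theorem add_smul_notMem_of_diam_lt (hb : Bornology.IsBounded Ω) {y : Space d} (hy : y ∈ Ω)
    (v : Velocity d) {s : ℝ} (hs : Metric.diam Ω < s) : y + s • (v : Space d) ∉ Ω := by
  intro h
  have := Metric.dist_le_diam_of_mem hb h hy
  rw [dist_eq_norm, add_sub_cancel_left, norm_smul, norm_velocity, mul_one] at this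
  exact absurd (hs.trans_le ((le_abs_self s).trans this)) (lt_irrefl _)

/-- Connectedness of the forward ray produces a boundary point on it. The strict supporting
inequality at that point, tested against the interior point y, excludes glancing directions. -/
theorem exists_exit (hΩ : IsOpen Ω) (hb : Bornology.IsBounded Ω) (hc : Convex ℝ Ω)
    (hs : HasSmoothBoundary Ω) {y : Space d} (hy : y ∈ Ω) (v : Velocity d) :
    ∃ τ : ℝ, (y + τ • (v : Space d), v) ∈ outgoing Ω := by
  set S := (fun s : ℝ => y + s • (v : Space d)) '' Icc 0 (Metric.diam Ω + 1)
  have hS : IsPreconnected S := isPreconnected_Icc.image _ (by fun_prop)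
  have hdiam : 0 ≤ Metric.diam Ω := Metric.diam_nonneg
  have h1 : (S ∩ Ω).Nonempty := ⟨y, ⟨0, ⟨le_rfl, by positivity⟩, by simp⟩, hy⟩
  have h2 : (S ∩ Ωᶜ).Nonempty :=
    ⟨y + (Metric.diam Ω + 1) • (v : Space d), ⟨_, ⟨by positivity, le_rfl⟩, rfl⟩,
      add_smul_notMem_of_diam_lt hb hy v (by linarith)⟩
  have h3 : (S ∩ frontier Ω).Nonempty := by
    by_contra hne
    have hfr : ∀ x ∈ S, x ∉ frontier Ω := fun x hx hx' => hne ⟨x, hx, hx'⟩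
    rw [hΩ.frontier_eq] at hfr
    obtain ⟨x, -, hx, hx'⟩ := hS Ω (closure Ω)ᶜ hΩ isClosed_closure.isOpen_compl
      (fun x hx => or_iff_not_imp_left.2 fun hx' hx'' => hfr x hx ⟨hx'', hx'⟩) h1
      (h2.mono fun x hx => ⟨hx.1, fun hx' => hfr x hx.1 ⟨hx', hx.2⟩⟩)
    exact hx' (subset_closure hx)
  obtain ⟨x, ⟨τ, hτ, rfl⟩, hx⟩ := h3
  obtain ⟨n, hn⟩ := hs _ hx
  refine ⟨τ, hx, n, hn, ?_⟩
  have := hn.inner_sub_neg hΩ hc hx hy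
  simp only [sub_add_cancel_left, inner_neg_right, inner_smul_right] at this
  by_contra hle
  linarith [mul_nonpos_of_nonneg_of_nonpos hτ.1 (not_lt.1 hle)]

/-- Linear coordinates `x ↦ (u, ⟨v, x⟩)` of `ℝ^d` in which the lines parallel to `v` are the fibres
`u = const`. -/
theorem exists_chart (v : Velocity d) :
    ∃ e : Space d ≃L[ℝ] (Fin (d - 1) → ℝ) × ℝ,
      (∀ x, (e x).2 = inner ℝ (v : Space d) x) ∧ e (v : Space d) = (0, 1) := by
  set f : Space d →ₗ[ℝ] ℝ := (innerSL ℝ (v : Space d)).toLinearMap with hf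
  have hfx : ∀ x, f x = inner ℝ (v : Space d) x := fun x => rfl
  have hfv : f (v : Space d) = 1 := by
    rw [hfx, real_inner_self_eq_norm_sq, norm_velocity, one_pow]
  have hf0 : f ≠ 0 := fun h => by simp [h] at hfv
  have hrank : Module.finrank ℝ (LinearMap.ker f) + 1 = d := by
    rw [Module.Dual.finrank_ker_add_one_of_ne_zero hf0, finrank_euclideanSpace_fin]
  let L : LinearMap.ker f ≃ₗ[ℝ] (Fin (d - 1) → ℝ) :=
    LinearEquiv.ofFinrankEq _ _ (by rw [Module.finrank_fin_fun]; omega)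
  let P : Space d →ₗ[ℝ] LinearMap.ker f :=
    (LinearMap.id - f.smulRight (v : Space d)).codRestrict (LinearMap.ker f) fun x => by
      simp [LinearMap.mem_ker, hfv]
  have hP : ∀ x, (P x : Space d) = x - f x • (v : Space d) := fun x => rfl
  let g : Space d →ₗ[ℝ] (Fin (d - 1) → ℝ) × ℝ := (L.toLinearMap ∘ₗ P).prod f
  have hinj : Function.Injective g := by
    rw [← LinearMap.ker_eq_bot, LinearMap.ker_eq_bot']
    intro x hx
    have h1 : L (P x) = 0 := congrArg Prod.fst hx
    have h2 : f x = 0 := congrArg Prod.snd hx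
    have h3 : P x = 0 := by simpa using h1
    have := hP x
    rwa [h3, h2, zero_smul, sub_zero, ZeroMemClass.coe_zero, eq_comm] at this
  let e := LinearEquiv.ofInjectiveOfFinrankEq g hinj
    (by rw [finrank_euclideanSpace_fin, Module.finrank_prod, Module.finrank_fin_fun,
          Module.finrank_self]; omega)
  refine ⟨e.toContinuousLinearEquiv, fun x => rfl, ?_⟩
  change g (v : Space d) = (0, 1)
  have hPv : P (v : Space d) = 0 := by
    ext1
    rw [hP, hfv, one_smul, sub_self, ZeroMemClass.coe_zero]
  exact Prod.ext (by simp [g, hPv]) hfv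

end NonlinearTransport

namespace NonlinearTransport

variable {d : ℕ} {Ω : Set (Space d)}

/-! ### The surface measure of the boundary -/

theorem hausdorffMeasure_fin_eq_volume (hd : 2 ≤ d) :
    (Measure.hausdorffMeasure ((d : ℝ) - 1) : Measure (Fin (d - 1) → ℝ)) = volume := by
  rw [← hausdorffMeasure_pi_real, Fintype.card_fin, Nat.cast_sub (by omega), Nat.cast_one]

/-- The inverse of u on A is Lipschitz, so the part of A lying over a bounded subset of ℝ^(d-1) has
finite Hausdorff measure. -/
theorem exists_countable_cover_hausdorffMeasure_lt_top (hd : 2 ≤ d) {A : Set (Space d)}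
    (u : Space d → Fin (d - 1) → ℝ) (K : NNReal)
    (hu : ∀ x ∈ A, ∀ y ∈ A, dist x y ≤ K * dist (u x) (u y)) :
    ∃ S : ℕ → Set (Space d), A ⊆ ⋃ i, S i ∧
      ∀ i, Measure.hausdorffMeasure ((d : ℝ) - 1) (S i) < ⊤ := by
  have hd' : (0 : ℝ) ≤ (d : ℝ) - 1 := by
    have : (2 : ℝ) ≤ d := by exact_mod_cast hd
    linarith
  refine ⟨fun i => A ∩ u ⁻¹' Metric.ball 0 i, fun x hx => ?_, fun i => ?_⟩
  · obtain ⟨i, hi⟩ := exists_nat_gt (dist (u x) 0)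
    exact mem_iUnion.2 ⟨i, hx, hi⟩
  · rcases A.eq_empty_or_nonempty with rfl | hA
    · simp
    have : Nonempty (Space d) := ⟨0⟩
    have hinj : InjOn u A := fun x hx y hy hxy => by
      have := hu x hx y hy
      rw [hxy, dist_self, mul_zero] at this
      exact dist_le_zero.1 this
    have hlip : LipschitzOnWith K (Function.invFunOn u A) (u '' A) := by
      refine LipschitzOnWith.of_dist_le_mul ?_
      rintro _ ⟨x, hx, rfl⟩ _ ⟨y, hy, rfl⟩
      rw [hinj.leftInvOn_invFunOn hx, hinj.leftInvOn_invFunOn hy]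
      exact hu x hx y hy
    have hsub : A ∩ u ⁻¹' Metric.ball 0 i ⊆
        Function.invFunOn u A '' (u '' A ∩ Metric.ball 0 i) := fun x hx =>
      ⟨u x, ⟨⟨x, hx.1, rfl⟩, hx.2⟩, hinj.leftInvOn_invFunOn hx.1⟩
    refine (measure_mono hsub).trans_lt ?_
    refine ((hlip.mono inter_subset_left).hausdorffMeasure_image_le hd').trans_lt ?_
    rw [hausdorffMeasure_fin_eq_volume hd]
    refine ENNReal.mul_lt_top (ENNReal.rpow_lt_top_of_nonneg hd' (by simp)) ?_
    exact (measure_mono inter_subset_right).trans_lt Metric.isBounded_ball.measure_lt_top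

/-- The part of the boundary facing the direction `w` has σ-finite surface measure: following outer
normals to a hyperplane `⟨w, z⟩ = R` does not decrease distances. -/
theorem exists_cover_frontier_facing (hd : 2 ≤ d) (hΩ : IsOpen Ω) (hb : Bornology.IsBounded Ω)
    (hc : Convex ℝ Ω) (w : Velocity d) :
    ∃ S : ℕ → Set (Space d),
      {x ∈ frontier Ω | ∃ n, IsOuterNormal Ω x n ∧ 0 < inner ℝ (w : Space d) n} ⊆ ⋃ i, S i ∧
      ∀ i, Measure.hausdorffMeasure ((d : ℝ) - 1) (S i) < ⊤ := by
  set A := {x ∈ frontier Ω | ∃ n, IsOuterNormal Ω x n ∧ 0 < inner ℝ (w : Space d) n} with hA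
  obtain ⟨R, hR⟩ := hb.closure.exists_norm_le
  have hAR : ∀ x ∈ A, inner ℝ (w : Space d) x ≤ R := fun x hx => by
    refine (real_inner_le_norm _ _).trans ?_
    rw [norm_velocity, one_mul]
    exact hR x (frontier_subset_closure hx.1)
  choose! n hn hwn using fun x (hx : x ∈ A) => hx.2
  obtain ⟨e, he, -⟩ := exists_chart w
  -- The point where the outer normal ray from x meets the hyperplane ⟨w, ·⟩ = R, which lies beyond
  -- all of `Ω`.
  set z : Space d → Space d := fun x =>
    x + ((R - inner ℝ (w : Space d) x) / inner ℝ (w : Space d) (n x)) • n x with hz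
  have hzR : ∀ x ∈ A, inner ℝ (w : Space d) (z x) = R := fun x hx => by
    have := (hwn x hx).ne'
    rw [hz, inner_add_right, inner_smul_right]
    field_simp
    ring
  have hle : ∀ x ∈ A, ∀ y ∈ A, inner ℝ (n x) (y - x) ≤ 0 := fun x hx y hy => by
    have hcl : y ∈ closure Ω := frontier_subset_closure hy.1
    have : closure Ω ⊆ {y | inner ℝ (n x) (y - x) ≤ 0} :=
      closure_minimal (fun y hy => (hn x hx).inner_sub_nonpos hΩ hc hx.1 hy)
        (isClosed_le (by fun_prop) continuous_const)
    exact this hcl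
  have hdist : ∀ x ∈ A, ∀ y ∈ A, dist x y ≤ dist (z x) (z y) := fun x hx y hy => by
    set a := (R - inner ℝ (w : Space d) x) / inner ℝ (w : Space d) (n x) with ha
    set b := (R - inner ℝ (w : Space d) y) / inner ℝ (w : Space d) (n y) with hb'
    have ha0 : 0 ≤ a := div_nonneg (by linarith [hAR x hx]) (hwn x hx).le
    have hb0 : 0 ≤ b := div_nonneg (by linarith [hAR y hy]) (hwn y hy).le
    have h1 := mul_nonpos_of_nonneg_of_nonpos ha0 (hle x hx y hy)
    have h2 := mul_nonpos_of_nonneg_of_nonpos hb0 (hle y hy x hx)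
    have hzz : z x - z y = (x - y) + (a • n x - b • n y) := by
      simp only [hz, ← ha, ← hb']
      abel
    -- Pairing z x - z y with x - y gives |x - y|² plus two cross terms, which are nonnegative by
    -- the supporting inequalities at x and at y.
    have h3 : ‖x - y‖ * ‖x - y‖ ≤ ‖z x - z y‖ * ‖x - y‖ := by
      refine le_trans ?_ (real_inner_le_norm _ _)
      rw [hzz, inner_add_left, real_inner_self_eq_norm_mul_norm, inner_sub_left, inner_smul_left,
        inner_smul_left, conj_trivial, conj_trivial]
      rw [← neg_sub x y, inner_neg_right] at h1
      linarith
    rw [dist_eq_norm, dist_eq_norm]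
    rcases (norm_nonneg (x - y)).eq_or_lt with h0 | h0
    · rw [← h0]; exact norm_nonneg _
    · exact le_of_mul_le_mul_right h3 h0
  refine exists_countable_cover_hausdorffMeasure_lt_top hd (fun x => (e (z x)).1)
    ‖(e.symm : (Fin (d - 1) → ℝ) × ℝ →L[ℝ] Space d)‖₊ fun x hx y hy => (hdist x hx y hy).trans ?_
  have h := e.symm.toContinuousLinearMap.le_opNorm (e (z x) - e (z y))
  have hx' : (e (z x) - e (z y)).2 = 0 := by
    rw [Prod.snd_sub, he, he, hzR x hx, hzR y hy, sub_self]
  have hnorm : ‖e (z x) - e (z y)‖ = ‖(e (z x)).1 - (e (z y)).1‖ := by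
    rw [Prod.norm_def, hx', Prod.fst_sub, norm_zero, max_eq_left (norm_nonneg _)]
  rw [hnorm] at h
  simpa [dist_eq_norm, map_sub] using h

/-- Every normal has positive inner product with one of the 2d vectors ±e_i, so finitely many facing
parts cover the boundary. The result is what permits Fubini on the boundary times the sphere. -/
theorem sigmaFinite_hausdorffMeasure_frontier (hd : 2 ≤ d) (hΩ : IsOpen Ω)
    (hb : Bornology.IsBounded Ω) (hc : Convex ℝ Ω) (hs : HasSmoothBoundary Ω) :
    SigmaFinite ((Measure.hausdorffMeasure ((d : ℝ) - 1)).restrict (frontier Ω)) := by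
  choose S hS hS' using exists_cover_frontier_facing hd hΩ hb hc
  let w : Fin d × Bool → Velocity d := fun p =>
    ⟨if p.2 then EuclideanSpace.single p.1 (1 : ℝ) else -EuclideanSpace.single p.1 (1 : ℝ), by
      rcases p with ⟨i, _ | _⟩ <;> simp⟩
  refine Measure.sigmaFinite_of_countable
    (S := range fun p : (Fin d × Bool) × ℕ => S (w p.1) p.2 ∪ (frontier Ω)ᶜ)
    (countable_range _) ?_ ?_
  · rintro _ ⟨p, rfl⟩
    rw [Measure.restrict_apply' isClosed_frontier.measurableSet]
    refine (measure_mono ?_).trans_lt (hS' (w p.1) p.2)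
    rintro x ⟨hx | hx, hx'⟩
    · exact hx
    · exact absurd hx' hx
  · rw [eq_univ_iff_forall]
    intro x
    have : Nonempty ((Fin d × Bool) × ℕ) := ⟨((⟨0, by omega⟩, true), 0)⟩
    by_cases hx : x ∈ frontier Ω
    · obtain ⟨n, hn⟩ := hs x hx
      have hn0 : n ≠ 0 := fun h => by simpa [h] using hn.1
      have : ∃ i, n i ≠ 0 := by
        by_contra hne
        push Not at hne
        exact hn0 (by ext i; simpa using hne i)
      obtain ⟨i, hi⟩ := this
      obtain ⟨p, hp⟩ : ∃ p, 0 < inner ℝ (w p : Space d) n := by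
        rcases lt_or_gt_of_ne hi with h | h
        · exact ⟨(i, false), by simpa [w, EuclideanSpace.inner_single_left] using h⟩
        · exact ⟨(i, true), by simpa [w, EuclideanSpace.inner_single_left] using h⟩
      obtain ⟨j, hj⟩ := mem_iUnion.1 (hS (w p) ⟨hx, n, hn, hp⟩)
      exact mem_sUnion.2 ⟨_, ⟨(p, j), rfl⟩, Or.inl hj⟩
    · exact mem_sUnion.2 ⟨_, ⟨Classical.arbitrary _, rfl⟩, Or.inr hx⟩

/-- If, from almost every outgoing boundary point, almost every point of the backward ray avoids
`D`, then `D ∩ Ω` is a null set. -/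
theorem ae_notMem_of_ae_frontier (hd : 2 ≤ d) (hΩ : IsOpen Ω) (hb : Bornology.IsBounded Ω)
    (hc : Convex ℝ Ω) (hs : HasSmoothBoundary Ω) {T : ℝ} (hT : Metric.diam Ω < T) (v : Velocity d)
    {D : Set (Space d)} (hD : MeasurableSet D)
    (hae : ∀ᵐ x ∂((Measure.hausdorffMeasure ((d : ℝ) - 1)).restrict (frontier Ω)),
      (x, v) ∈ outgoing Ω → ∀ᵐ t ∂(volume.restrict (Ioo 0 T)), x - t • (v : Space d) ∉ D) :
    ∀ᵐ y ∂(volume.restrict Ω), y ∉ D := by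
  have hd' : (0 : ℝ) ≤ (d : ℝ) - 1 := by
    have : (2 : ℝ) ≤ d := by exact_mod_cast hd
    linarith
  obtain ⟨e, he, hev⟩ := exists_chart v
  have hev' : ∀ s : ℝ, e.symm ((0 : Fin (d - 1) → ℝ), s) = s • (v : Space d) := fun s => by
    rw [ContinuousLinearEquiv.symm_apply_eq, map_smul, hev]
    simp
  have hline : ∀ (u : Fin (d - 1) → ℝ) (a b : ℝ),
      e.symm (u, b) = e.symm (u, a) + (b - a) • (v : Space d) := fun u a b => by
    rw [← hev', ← map_add]
    simp
  rw [ae_restrict_iff' hΩ.measurableSet]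
  rw [ae_restrict_iff' isClosed_frontier.measurableSet, ae_iff] at hae
  set A := {x : Space d | ¬(x ∈ frontier Ω → (x, v) ∈ outgoing Ω →
    ∀ᵐ t ∂(volume.restrict (Ioo 0 T)), x - t • (v : Space d) ∉ D)} with hA
  have hπ : LipschitzWith ‖(ContinuousLinearMap.fst ℝ (Fin (d - 1) → ℝ) ℝ).comp
      (e : Space d →L[ℝ] (Fin (d - 1) → ℝ) × ℝ)‖₊ fun x => (e x).1 :=
    ((ContinuousLinearMap.fst ℝ (Fin (d - 1) → ℝ) ℝ).comp
      (e : Space d →L[ℝ] (Fin (d - 1) → ℝ) × ℝ)).lipschitz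
  -- Projection along v is Lipschitz, so the bad boundary points meet only a null set of lines
  -- parallel to v.
  have hnull : volume ((fun x => (e x).1) '' A) = 0 := by
    rw [← hausdorffMeasure_fin_eq_volume hd]
    have := hπ.hausdorffMeasure_image_le hd' A
    rw [hae, mul_zero] at this
    exact le_antisymm this bot_le
  have hsymm : Measurable e.symm := e.symm.continuous.measurable
  have hac : (volume : Measure (Space d)) ≪
      ((volume : Measure (Fin (d - 1) → ℝ)).prod (volume : Measure ℝ)).map e.symm := by
    have : (((volume : Measure (Fin (d - 1) → ℝ)).prod (volume : Measure ℝ)).map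
        e.symm).IsAddHaarMeasure := e.symm.isAddHaarMeasure_map _
    exact Measure.absolutelyContinuous_isAddHaarMeasure _ _
  have hmeas : MeasurableSet {y | y ∈ Ω → y ∉ D} := by
    have : {y | y ∈ Ω → y ∉ D} = Ωᶜ ∪ Dᶜ := by
      ext y; simp [imp_iff_not_or]
    rw [this]
    exact hΩ.measurableSet.compl.union hD.compl
  refine hac.ae_le ?_
  refine (ae_map_iff hsymm.aemeasurable hmeas).2 ((Measure.ae_prod_iff_ae_ae (hsymm hmeas)).2 ?_)
  have hu : ∀ᵐ u ∂(volume : Measure (Fin (d - 1) → ℝ)), u ∉ (fun x => (e x).1) '' A :=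
    measure_eq_zero_iff_ae_notMem.1 hnull
  filter_upwards [hu] with u hu
  by_cases hex : ∃ s₀, e.symm (u, s₀) ∈ Ω
  swap
  · exact ae_of_all _ fun s hs => absurd ⟨s, hs⟩ hex
  obtain ⟨s₀, hs₀⟩ := hex
  obtain ⟨τ, hτ⟩ := exists_exit hΩ hb hc hs hs₀ v
  set x := e.symm (u, s₀) + τ • (v : Space d) with hx
  have hxe : x = e.symm (u, s₀ + τ) := by rw [hline u s₀, hx, add_sub_cancel_left]
  have hxA : x ∉ A := fun h => hu ⟨x, h, by simp [hxe]⟩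
  have hgood : ∀ᵐ t ∂(volume.restrict (Ioo 0 T)), x - t • (v : Space d) ∉ D := by
    by_contra hbad
    exact hxA fun h => hbad (h hτ.1 hτ)
  rw [ae_restrict_iff' measurableSet_Ioo] at hgood
  -- Backward time t from the exit point corresponds to the line parameter s = s₀ + τ - t. For
  -- points of `Ω` this t is positive, since nothing of `Ω` lies past the exit, and less than T by
  -- the diameter bound.
  have hsub := (Measure.measurePreserving_sub_left (volume : Measure ℝ) (s₀ + τ)).quasiMeasurePreserving.ae
    hgood
  filter_upwards [hsub] with s hs' hsΩ
  have heq : x - (s₀ + τ - s) • (v : Space d) = e.symm (u, s) := by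
    rw [hline u (s₀ + τ) s, ← hxe, sub_eq_add_neg, ← neg_smul, neg_sub]
  rw [heq] at hs'
  refine hs' ⟨?_, ?_⟩
  · by_contra hle
    refine add_smul_notMem_of_outgoing hΩ hc hτ (r := s - (s₀ + τ)) (by linarith) ?_
    rwa [hxe, ← hline]
  · have hcl : x ∈ closure Ω := frontier_subset_closure hτ.1
    have := Metric.dist_le_diam_of_mem hb.closure hcl (subset_closure hsΩ)
    rw [Metric.diam_closure, ← heq, dist_eq_norm, sub_sub_cancel, norm_smul, norm_velocity,
      mul_one] at this
    exact (le_abs_self _).trans_lt (this.trans_lt hT)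

end NonlinearTransport

namespace NonlinearTransport

variable {d : ℕ} {Ω : Set (Space d)} {M T : ℝ} {σ q : Space d × Velocity d → ℝ}
  {k : Space d × Velocity d × Velocity d → ℝ} {N : ℝ → ℝ} {h : Space d × Velocity d → ℝ}
  {F : (Space d × Velocity d) × ℝ → ℝ}

/-! ### Traces -/

theorem tendsto_average_zero {c : ℝ → ℝ} (hc : Continuous c) :
    Tendsto (fun ε : ℝ => ε⁻¹ * ∫ s in (0 : ℝ)..ε, c s) (𝓝[>] 0) (𝓝 (c 0)) := by
  have h := (hc.integral_hasStrictDerivAt 0 0).hasDerivAt.hasDerivWithinAt (s := Ioi 0)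
  rw [hasDerivWithinAt_iff_tendsto_slope' (by simp)] at h
  refine h.congr fun ε => ?_
  simp [slope_def_field, div_eq_inv_mul]

theorem IsCharSolution.zero (hF : IsCharSolution σ q k N h F) (z : Space d × Velocity d) :
    F (z, 0) = h z := by
  simp [hF.eq_add_integral z 0 le_rfl]

theorem IsCharSolution.hasInitialTrace (hF : IsCharSolution σ q k N h F) :
    HasInitialTrace Ω (physical F) h := by
  refine ae_of_all _ fun z => ?_
  have := tendsto_average_zero (hF.continuous z)
  simp only [hF.zero] at this
  simpa [physical] using this

theorem IsCharSolution.hasOutgoingTrace (hF : IsCharSolution σ q k N h F) :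
    HasOutgoingTrace Ω T (physical F) (physical F) := by
  refine ae_of_all _ fun p => ?_
  have := tendsto_average_zero (c := fun s => F ((p.1.1 - p.2 • (p.1.2 : Space d), p.1.2), p.2 - s))
    ((hF.continuous _).comp (by fun_prop))
  simp only [sub_zero] at this
  simpa [physical, sub_smul] using this

/-- The backward ray from an incoming point never meets `Ω`, so both the datum and the right-hand
side vanish on it. -/
theorem IsCharSolution.eq_zero_of_incoming (hr : IsRegular Ω M σ q k N)
    (hF : IsCharSolution σ q k N h F) (hh : ∀ z, z.1 ∉ Ω → h z = 0) (hΩ : IsOpen Ω)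
    (hc : Convex ℝ Ω) {z : Space d × Velocity d} (hz : z ∈ incoming Ω) {t : ℝ} (ht : 0 ≤ t) :
    physical F (z, t) = 0 := by
  have hout : ∀ r : ℝ, 0 ≤ r → z.1 - r • (z.2 : Space d) ∉ Ω := fun r hr' =>
    sub_smul_notMem_of_incoming hΩ hc (x := z.1) (v := z.2) hz hr'
  rw [physical, hF.eq_add_integral _ t ht, hh _ (hout t ht), zero_add]
  refine intervalIntegral.integral_zero_ae (ae_of_all _ fun s hs => ?_)
  rw [uIoc_of_le ht] at hs
  refine collision_eq_zero hr F ?_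
  have := hout (t - s) (by linarith [hs.2])
  rwa [sub_smul, ← sub_add] at this

theorem IsCharSolution.hasIncomingTrace (hr : IsRegular Ω M σ q k N)
    (hF : IsCharSolution σ q k N h F) (hh : ∀ z, z.1 ∉ Ω → h z = 0) (hΩ : IsOpen Ω)
    (hc : Convex ℝ Ω) : HasIncomingTrace Ω T (physical F) fun _ => 0 := by
  have htend : ∀ p : (Space d × Velocity d) × ℝ,
      Tendsto (fun ε : ℝ => ε⁻¹ * ∫ s in (0 : ℝ)..ε,
        physical F ((p.1.1 + s • (p.1.2 : Space d), p.1.2), p.2 + s)) (𝓝[>] 0)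
        (𝓝 (physical F p)) := by
    intro p
    have := tendsto_average_zero
      (c := fun s => F ((p.1.1 - p.2 • (p.1.2 : Space d), p.1.2), p.2 + s))
      ((hF.continuous _).comp (by fun_prop))
    simp only [add_zero] at this
    refine this.congr fun ε => ?_
    congr 2
    ext s
    simp only [physical]
    congr 3
    rw [add_smul]
    abel
  have hm : Measurable (physical F) := measurable_physical hF.measurable
  have hzero : ∀ᵐ p ∂(boundaryTimeMeasure Ω (incoming Ω) T), physical F p = 0 := by
    have hset : MeasurableSet {p | physical F p = 0} := hm (measurableSet_singleton 0)
    rw [boundaryTimeMeasure, Measure.ae_prod_iff_ae_ae hset]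
    -- Restricting to `incoming Ω` uses measurability of the property, so that of `incoming Ω`
    -- itself is not required.
    have hset' : MeasurableSet {z : Space d × Velocity d |
        ∀ᵐ t ∂(volume.restrict (Ioo 0 T)), physical F (z, t) = 0} := by
      have := measurable_measure_prodMk_left (ν := (volume : Measure ℝ).restrict (Ioo 0 T)) hset.compl
      exact this (measurableSet_singleton 0)
    rw [ae_restrict_iff hset']
    refine ae_of_all _ fun z hz => ?_
    filter_upwards [ae_restrict_mem measurableSet_Ioo] with t ht
    exact hF.eq_zero_of_incoming hr hh hΩ hc hz ht.1.le
  filter_upwards [hzero] with p hp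
  have := htend p
  rwa [hp] at this

/-! ### Solutions for coefficients given almost everywhere -/

/-- The scattering integral runs over the middle variable, so the two velocities are exchanged
before Fubini is applied. -/
theorem ae_ae_scattering_eq {μ k : Space d × Velocity d × Velocity d → ℝ}
    (hμ : μ =ᵐ[phaseMeasure₂ Ω] k) :
    ∀ᵐ z ∂(phaseMeasure Ω), ∀ᵐ v' ∂(sphereMeasure d), μ (z.1, v', z.2) = k (z.1, v', z.2) := by
  have h1 : MeasurePreserving
      (fun p : (Space d × Velocity d) × Velocity d => (p.1.1, (p.2, p.1.2)))
      ((phaseMeasure Ω).prod (sphereMeasure d)) (phaseMeasure₂ Ω) :=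
    ((MeasurePreserving.id (volume.restrict Ω)).prod
      (Measure.measurePreserving_swap (μ := sphereMeasure d) (ν := sphereMeasure d))).comp
      (measurePreserving_prodAssoc (volume.restrict Ω) (sphereMeasure d) (sphereMeasure d))
  exact Measure.ae_ae_of_ae_prod (h1.quasiMeasurePreserving.ae hμ)

theorem isWeakSolution_congr {σ' q' : Space d × Velocity d → ℝ}
    {μ k : Space d × Velocity d × Velocity d → ℝ} {N N' : ℝ → ℝ}
    {f : (Space d × Velocity d) × ℝ → ℝ} (hσ : σ' =ᵐ[phaseMeasure Ω] σ)
    (hq : q' =ᵐ[phaseMeasure Ω] q) (hμ : μ =ᵐ[phaseMeasure₂ Ω] k)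
    (hN : ∀ᵐ p ∂(phaseTimeMeasure Ω T), N' (f p) = N (f p))
    (hf : IsWeakSolution Ω T σ k (fun z y => q z * N y) f) :
    IsWeakSolution Ω T σ' μ (fun z y => q' z * N' y) f := by
  intro φ hφ hφc hφs
  rw [hf φ hφ hφc hφs]
  refine integral_congr_ae ?_
  have hfst : ∀ {P : Space d × Velocity d → Prop}, (∀ᵐ z ∂(phaseMeasure Ω), P z) →
      ∀ᵐ p ∂(phaseTimeMeasure Ω T), P p.1 := fun hP =>
    Measure.quasiMeasurePreserving_fst.ae hP
  filter_upwards [hfst hσ, hfst hq, hN, hfst (ae_ae_scattering_eq hμ)] with p h1 h2 h3 h4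
  have : scattering μ f p = scattering k f p :=
    integral_congr_ae (by filter_upwards [h4] with v' hv'; rw [hv'])
  rw [h1, h2, h3, this]

/-- Since the solution stays in [-1, 1], the original nonlinearity may replace the globally
Lipschitz one with which it was constructed. -/
theorem isMeasurement_physical {σ' q' : Space d × Velocity d → ℝ}
    {μ : Space d × Velocity d × Velocity d → ℝ} {N' : ℝ → ℝ} (hd : 2 ≤ d)
    (hr : IsRegular Ω M σ q k N) (hσ : σ' =ᵐ[phaseMeasure Ω] σ) (hq : q' =ᵐ[phaseMeasure Ω] q)
    (hμ : μ =ᵐ[phaseMeasure₂ Ω] k) (hΩ : IsOpen Ω) (hΩb : Bornology.IsBounded Ω)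
    (hc : Convex ℝ Ω) (hT : 0 ≤ T) (hN : ∀ a, |a| ≤ 1 → N' a = N a)
    (hF : IsCharSolution σ q k N h F) (hb : ∀ z, ∀ t ∈ Icc 0 T, |F (z, t)| ≤ 1)
    (hh : ∀ z, z.1 ∉ Ω → h z = 0) :
    IsMeasurement Ω T σ' μ (fun z y => q' z * N' y) h (fun _ => 0) (physical F) := by
  have hfin := isFiniteMeasure_phaseTimeMeasure hΩb T
  have htime : ∀ᵐ p ∂(phaseTimeMeasure Ω T), p.2 ∈ Ioo 0 T :=
    Measure.quasiMeasurePreserving_snd.ae (ae_restrict_mem measurableSet_Ioo)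
  have hb' : ∀ᵐ p ∂(phaseTimeMeasure Ω T), |physical F p| ≤ 1 := by
    filter_upwards [htime] with p hp using hb _ _ ⟨hp.1.le, hp.2.le⟩
  refine ⟨physical F, ⟨?_, ?_, hF.hasInitialTrace, hF.hasIncomingTrace hr hh hΩ hc⟩,
    hF.hasOutgoingTrace⟩
  · exact MemLp.of_bound (measurable_physical hF.measurable).aestronglyMeasurable 1 hb'
  · refine isWeakSolution_congr hσ hq hμ ?_
      (isWeakSolution_physical hr hd hΩ.measurableSet hΩb hT hF zero_le_one hb)
    filter_upwards [hb'] with p hp using hN _ hp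

/-! ### From outgoing traces to final values along characteristics -/

/-- Past an outgoing point the ray stays outside `Ω`, so the value at the exit time t is kept until
T. -/
theorem IsCharSolution.eq_final_of_outgoing (hr : IsRegular Ω M σ q k N)
    (hF : IsCharSolution σ q k N h F) (hΩ : IsOpen Ω)
    (hc : Convex ℝ Ω) {z : Space d × Velocity d} (hz : z ∈ outgoing Ω) {t : ℝ}
    (ht : t ∈ Icc 0 T) :
    physical F (z, t) = F ((z.1 - t • (z.2 : Space d), z.2), T) := by
  rw [physical, hF.eq_add_integral _ t ht.1, hF.eq_add_integral _ T (ht.1.trans ht.2),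
    add_right_inj, ← intervalIntegral.integral_add_adjacent_intervals
      (hF.intervalIntegrable _ 0 t) (hF.intervalIntegrable _ t T), eq_comm, add_eq_left]
  refine intervalIntegral.integral_zero_ae (ae_of_all _ fun s hs => ?_)
  rw [uIoc_of_le ht.2] at hs
  refine collision_eq_zero hr F ?_
  have := add_smul_notMem_of_outgoing hΩ hc (x := z.1) (v := z.2) hz (r := s - t)
    (by linarith [hs.1])
  rwa [sub_smul, add_sub, ← sub_add_eq_add_sub] at this

/-- For fixed v, apply `ae_notMem_of_ae_frontier` to the set of starting points whose final values
differ: the exit point and exit time determine the starting point. -/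
theorem ae_final_eq_of_ae_outgoing {M₁ M₂ : ℝ} {σ₁ q₁ σ₂ q₂ : Space d × Velocity d → ℝ}
    {k₁ k₂ : Space d × Velocity d × Velocity d → ℝ} {N₁ N₂ : ℝ → ℝ}
    {h₁ h₂ : Space d × Velocity d → ℝ} {F₁ F₂ : (Space d × Velocity d) × ℝ → ℝ}
    (hd : 2 ≤ d) (hΩ : IsOpen Ω) (hb : Bornology.IsBounded Ω) (hc : Convex ℝ Ω)
    (hs : HasSmoothBoundary Ω) (hT : Metric.diam Ω < T)
    (hr₁ : IsRegular Ω M₁ σ₁ q₁ k₁ N₁) (hr₂ : IsRegular Ω M₂ σ₂ q₂ k₂ N₂)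
    (hF₁ : IsCharSolution σ₁ q₁ k₁ N₁ h₁ F₁) (hF₂ : IsCharSolution σ₂ q₂ k₂ N₂ h₂ F₂)
    (hae : physical F₁ =ᵐ[boundaryTimeMeasure Ω (outgoing Ω) T] physical F₂) :
    ∀ᵐ z ∂(phaseMeasure Ω), F₁ (z, T) = F₂ (z, T) := by
  have hσf := sigmaFinite_hausdorffMeasure_frontier hd hΩ hb hc hs
  have hm₁ : Measurable fun z => F₁ (z, T) := hF₁.measurable.comp measurable_prodMk_right
  have hm₂ : Measurable fun z => F₂ (z, T) := hF₂.measurable.comp measurable_prodMk_right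
  have hD : MeasurableSet {z | F₁ (z, T) ≠ F₂ (z, T)} := (measurableSet_eq_fun hm₁ hm₂).compl
  have h1 := ae_imp_of_ae_restrict (Measure.ae_ae_of_ae_prod hae)
  have h2 := Measure.ae_ae_of_ae_prod
    ((Measure.measurePreserving_swap (μ := sphereMeasure d)
      (ν := (Measure.hausdorffMeasure ((d : ℝ) - 1)).restrict
        (frontier Ω))).quasiMeasurePreserving.ae h1)
  have h3 : ∀ᵐ v ∂(sphereMeasure d), ∀ᵐ y ∂(volume.restrict Ω), F₁ ((y, v), T) = F₂ ((y, v), T) := by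
    filter_upwards [h2] with v hv
    have := ae_notMem_of_ae_frontier hd hΩ hb hc hs hT v
      (D := (fun y => (y, v)) ⁻¹' {z | F₁ (z, T) ≠ F₂ (z, T)})
      (measurable_prodMk_right hD) ?_
    · filter_upwards [this] with y hy
      simpa using hy
    · filter_upwards [hv] with x hx hout
      filter_upwards [hx hout, ae_restrict_mem measurableSet_Ioo] with t ht htT
      have ht' : t ∈ Icc 0 T := ⟨htT.1.le, htT.2.le⟩
      simp only [Prod.swap] at ht
      rw [hF₁.eq_final_of_outgoing hr₁ hΩ hc hout ht',
        hF₂.eq_final_of_outgoing hr₂ hΩ hc hout ht'] at ht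
      simpa using ht
  have hDs : MeasurableSet {p : Velocity d × Space d | F₁ (p.swap, T) = F₂ (p.swap, T)} :=
    measurable_swap (measurableSet_eq_fun hm₁ hm₂)
  have h4 := (Measure.ae_prod_iff_ae_ae (μ := sphereMeasure d) (ν := volume.restrict Ω) hDs).2 h3
  exact (Measure.measurePreserving_swap (μ := volume.restrict Ω)
    (ν := sphereMeasure d)).quasiMeasurePreserving.ae h4

end NonlinearTransport

namespace NonlinearTransport

/-! ### Injectivity of the attenuated ray transform along partial rays -/

/-- The tail integral is continuous in its lower limit, so it vanishes on all of the open set U;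
Lebesgue differentiation then gives ψ = 0 almost everywhere there. -/
theorem ae_eq_zero_of_ae_tail_integral_eq_zero {ψ : ℝ → ℝ} (hψ : ∀ a b, IntervalIntegrable ψ volume a b)
    {U : Set ℝ} (hU : IsOpen U) (hψU : ∀ s, s ∉ U → ψ s = 0) {b : ℝ}
    (h : ∀ᵐ ε, ε ∈ U → ∫ s in ε..b, ψ s = 0) : ∀ᵐ s, ψ s = 0 := by
  have hsymm : ∀ ε, ∫ s in ε..b, ψ s = -∫ s in b..ε, ψ s := fun ε =>
    intervalIntegral.integral_symm _ _
  have hcont : Continuous fun ε => ∫ s in ε..b, ψ s := by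
    simp only [hsymm]
    exact (intervalIntegral.continuous_primitive hψ b).neg
  have hzero : ∀ ε ∈ U, ∫ s in ε..b, ψ s = 0 := by
    have hopen : IsOpen (U ∩ {ε | ∫ s in ε..b, ψ s ≠ 0}) :=
      hU.inter (isOpen_ne_fun hcont continuous_const)
    have hnull : volume (U ∩ {ε | ∫ s in ε..b, ψ s ≠ 0}) = 0 := by
      refine measure_mono_null (fun ε hε => ?_) (ae_iff.1 h)
      simpa using hε
    have hempty := (hopen.measure_eq_zero_iff volume).1 hnull
    intro ε hε
    by_contra hne
    exact (hempty ▸ (⟨hε, hne⟩ : ε ∈ U ∩ {ε | ∫ s in ε..b, ψ s ≠ 0}) : ε ∈ (∅ : Set ℝ))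
  have hloc : LocallyIntegrable ψ volume := by
    refine (locallyIntegrable_iff).2 fun K hK => ?_
    obtain ⟨a, c, hac⟩ := bddBelow_bddAbove_iff_subset_Icc.1 ⟨hK.bddBelow, hK.bddAbove⟩
    rcases le_or_gt a c with hle | hlt
    · exact ((intervalIntegrable_iff_integrableOn_Icc_of_le hle).1 (hψ a c)).mono_set hac
    · rw [Icc_eq_empty_of_lt hlt] at hac
      rw [subset_empty_iff.1 hac]
      exact integrableOn_empty
  filter_upwards [LocallyIntegrable.ae_hasDerivAt_integral hloc] with s hs
  by_cases hsU : s ∈ U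
  · have h1 : (fun x => ∫ t in b..x, ψ t) =ᶠ[𝓝 s] fun _ => 0 := by
      filter_upwards [hU.mem_nhds hsU] with x hx
      have := hzero x hx
      rw [hsymm, neg_eq_zero] at this
      exact this
    exact ((hs b).congr_of_eventuallyEq h1.symm).unique (hasDerivAt_const s (0 : ℝ))
  · exact hψU s hsU

variable {d : ℕ} {Ω : Set (Space d)} {M T : ℝ}

theorem intervalIntegrable_along {σ : Space d × Velocity d → ℝ} (hσm : Measurable σ)
    (hσ : ∀ z, |σ z| ≤ M) (z : Space d × Velocity d) (a b : ℝ) :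
    IntervalIntegrable (fun r => σ (z.1 + r • (z.2 : Space d), z.2)) volume a b := by
  have hm : Measurable fun r : ℝ => σ (z.1 + r • (z.2 : Space d), z.2) := hσm.comp (by fun_prop)
  exact (intervalIntegrable_const (c := M)).mono_fun' hm.aestronglyMeasurable
    (ae_of_all _ fun r => hσ _)

theorem ae_ae_along_of_ae {P : Space d × Velocity d → Prop}
    (hP : ∀ᵐ z ∂((volume : Measure (Space d)).prod (sphereMeasure d)), P z) :
    ∀ᵐ z ∂((volume : Measure (Space d)).prod (sphereMeasure d)), ∀ᵐ s : ℝ,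
      P (z.1 + s • (z.2 : Space d), z.2) := by
  have h1 : ∀ᵐ p ∂(((volume : Measure (Space d)).prod (sphereMeasure d)).prod
      (volume : Measure ℝ)), P p.1 := Measure.quasiMeasurePreserving_fst.ae hP
  exact Measure.ae_ae_of_ae_prod
    ((measurePreserving_shear (volume : Measure ℝ)).quasiMeasurePreserving.ae h1)

theorem ae_eq_zero_of_ae_ae_along {p : Space d × Velocity d → ℝ} (hp : Measurable p)
    (h : ∀ᵐ z ∂((volume : Measure (Space d)).prod (sphereMeasure d)), ∀ᵐ s : ℝ,
      p (z.1 + s • (z.2 : Space d), z.2) = 0) :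
    ∀ᵐ z ∂((volume : Measure (Space d)).prod (sphereMeasure d)), p z = 0 := by
  have hsh := measurePreserving_shear (d := d) (volume : Measure ℝ)
  have hset : MeasurableSet {r : (Space d × Velocity d) × ℝ | p r.1 = 0} :=
    (hp.comp measurable_fst) (measurableSet_singleton 0)
  have h1 := (Measure.ae_prod_iff_ae_ae (hsh.measurable hset)).2 h
  have h2 := (ae_map_iff hsh.measurable.aemeasurable hset).2 h1
  rw [hsh.map_eq] at h2
  filter_upwards [Measure.ae_ae_of_ae_prod h2] with z hz
  exact hz.exists.choose_spec

/-- Moving the starting point along a line only multiplies the attenuated integral by a nonzero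
factor. Up to that factor, all these integrals are tails of a single function ψ on the line. -/
theorem ae_eq_zero_of_ae_ray_integral_eq_zero (hΩ : IsOpen Ω) (hb : Bornology.IsBounded Ω)
    (hT : Metric.diam Ω < T) {p σ : Space d × Velocity d → ℝ} (hpm : Measurable p)
    (hp : ∀ z, |p z| ≤ M) (hp0 : ∀ z, z.1 ∉ Ω → p z = 0) (hσm : Measurable σ)
    (hσ : ∀ z, |σ z| ≤ M)
    (H : ∀ᵐ z ∂(phaseMeasure Ω), ∫ s in 0..T, p (z.1 + s • (z.2 : Space d), z.2) *
      Real.exp (-∫ r in 0..s, σ (z.1 + r • (z.2 : Space d), z.2)) = 0) :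
    ∀ᵐ z ∂(phaseMeasure Ω), p z = 0 := by
  have hrestr : phaseMeasure Ω =
      ((volume : Measure (Space d)).prod (sphereMeasure d)).restrict (Ω ×ˢ univ) := by
    rw [phaseMeasure, ← Measure.prod_restrict, Measure.restrict_univ]
  rw [hrestr] at H ⊢
  refine ae_restrict_of_ae (ae_eq_zero_of_ae_ae_along hpm ?_)
  filter_upwards [ae_ae_along_of_ae (ae_imp_of_ae_restrict H)] with z hz
  set U : Set ℝ := {s | z.1 + s • (z.2 : Space d) ∈ Ω} with hU
  have hUo : IsOpen U := hΩ.preimage (by fun_prop)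
  have hUT : ∀ a ∈ U, ∀ s ∈ U, s < a + T := by
    intro a ha s hs
    by_contra hle
    refine add_smul_notMem_of_diam_lt hb ha z.2 (s := s - a) (by linarith) ?_
    rwa [add_assoc, ← add_smul, add_sub_cancel]
  set S : ℝ → ℝ := fun s => ∫ r in 0..s, σ (z.1 + r • (z.2 : Space d), z.2) with hS
  have hσi := intervalIntegrable_along hσm hσ z
  have hSc : Continuous S := intervalIntegral.continuous_primitive hσi 0
  set ψ : ℝ → ℝ := fun s => p (z.1 + s • (z.2 : Space d), z.2) * Real.exp (-S s) with hψ
  have hψi : ∀ a b, IntervalIntegrable ψ volume a b := fun a b =>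
    (intervalIntegrable_along hpm hp z a b).mul_continuousOn (by fun_prop)
  have hψU : ∀ s, s ∉ U → ψ s = 0 := fun s hs => by
    simp only [hψ, hp0 (z.1 + s • (z.2 : Space d), z.2) hs, zero_mul]
  suffices h : ∀ᵐ s, ψ s = 0 by
    filter_upwards [h] with s hs
    exact (mul_eq_zero.1 hs).resolve_right (Real.exp_pos _).ne'
  rcases U.eq_empty_or_nonempty with hUe | ⟨e₀, he₀⟩
  · exact ae_of_all _ fun s => hψU s (by simp [hUe])
  -- All tails need a common endpoint. Any e₀ in U serves, because ψ vanishes beyond a + T for every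
  -- a in U.
  refine ae_eq_zero_of_ae_tail_integral_eq_zero hψi hUo hψU (b := e₀ + T) ?_
  filter_upwards [hz] with ε hε hεU
  have hε' := hε ⟨hεU, mem_univ _⟩
  have htail : ∫ s in (ε + T)..(e₀ + T), ψ s = 0 := by
    refine intervalIntegral.integral_zero_ae (ae_of_all _ fun s hs => hψU s fun hsU => ?_)
    have h1 := hUT _ hεU _ hsU
    have h2 := hUT _ he₀ _ hsU
    rw [uIoc, mem_Ioc, min_lt_iff] at hs
    rcases hs.1 with h | h <;> linarith
  rw [← intervalIntegral.integral_add_adjacent_intervals (hψi ε (ε + T)) (hψi (ε + T) (e₀ + T)),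
    htail, add_zero]
  have hshift : ∫ s in ε..(ε + T), ψ s = ∫ s in 0..T, ψ (ε + s) := by
    rw [intervalIntegral.integral_comp_add_left ψ ε, add_zero]
  have hfac : ∀ s, ψ (ε + s) = Real.exp (-S ε) *
      (p (z.1 + ε • (z.2 : Space d) + s • (z.2 : Space d), z.2) *
        Real.exp (-∫ r in 0..s, σ (z.1 + ε • (z.2 : Space d) + r • (z.2 : Space d), z.2))) := by
    intro s
    have h1 : ∫ r in 0..s, σ (z.1 + ε • (z.2 : Space d) + r • (z.2 : Space d), z.2) =
        S (ε + s) - S ε := by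
      simp only [hS, add_assoc, ← add_smul]
      rw [intervalIntegral.integral_interval_sub_left (hσi _ _) (hσi _ _),
        intervalIntegral.integral_comp_add_left
          (fun r => σ (z.1 + r • (z.2 : Space d), z.2)) ε, add_zero]
    rw [h1]
    simp only [hψ, add_assoc, ← add_smul]
    rw [mul_left_comm, ← Real.exp_add]
    congr 2
    ring
  rw [hshift]
  simp only [hfac]
  rw [intervalIntegral.integral_const_mul, hε', mul_zero]

end NonlinearTransport

namespace NonlinearTransport

/-! ### Expansion of the solution along a ray for small data -/

/-- `F n` solves `F' = -σ F - κ N(F) + K` with the small initial value `lam n`, the source `K` being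
of third order. -/
structure IsSmallRaySolution (T M C : ℝ) (σ κ N : ℝ → ℝ) (lam : ℕ → ℝ) (F K : ℕ → ℝ → ℝ) :
    Prop where
  nonneg_T : 0 ≤ T
  nonneg_M : 0 ≤ M
  nonneg_C : 0 ≤ C
  measurable_σ : Measurable σ
  measurable_κ : Measurable κ
  continuous_N : Continuous N
  σ_le : ∀ t, |σ t| ≤ M
  κ_le : ∀ t, |κ t| ≤ M
  N_le : ∀ a, |N a| ≤ C * a ^ 2
  lam_pos : ∀ n, 0 < lam n
  lam_le : ∀ n, lam n ≤ 1
  lam_tendsto : Tendsto lam atTop (𝓝 0)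
  continuous_F : ∀ n, Continuous (F n)
  measurable_K : ∀ n, Measurable (K n)
  F_le : ∀ n, ∀ t ∈ Icc 0 T, |F n t| ≤ C * lam n
  K_le : ∀ n, ∀ t ∈ Icc 0 T, |K n t| ≤ C * lam n ^ 3
  eq_add_integral : ∀ n, ∀ t ∈ Icc 0 T,
    F n t = lam n + ∫ s in 0..t, (-(σ s * F n s) + (-(κ s * N (F n s)) + K n s))

variable {T M C : ℝ} {σ κ N : ℝ → ℝ} {lam : ℕ → ℝ} {F K : ℕ → ℝ → ℝ}

namespace IsSmallRaySolution

theorem abs_source_le (h : IsSmallRaySolution T M C σ κ N lam F K) (n : ℕ) {t : ℝ}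
    (ht : t ∈ Icc 0 T) : |-(κ t * N (F n t)) + K n t| ≤ (M * (C * C ^ 2) + C) * lam n ^ 2 := by
  have hM := h.nonneg_M
  have hC := h.nonneg_C
  have hl := (h.lam_pos n).le
  have h1 : |κ t * N (F n t)| ≤ M * (C * (C * lam n) ^ 2) := by
    rw [abs_mul]
    refine mul_le_mul (h.κ_le t) ((h.N_le _).trans ?_) (abs_nonneg _) hM
    rw [← sq_abs (F n t)]
    have := h.F_le n t ht
    gcongr
  have h2 : C * lam n ^ 3 ≤ C * lam n ^ 2 :=
    mul_le_mul_of_nonneg_left (pow_le_pow_of_le_one hl (h.lam_le n) (by norm_num)) hC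
  refine (abs_add_le _ _).trans ?_
  rw [abs_neg]
  have h3 := h.K_le n t ht
  calc _ ≤ M * (C * (C * lam n) ^ 2) + C * lam n ^ 2 := by linarith
    _ = _ := by ring

theorem measurable_source (h : IsSmallRaySolution T M C σ κ N lam F K) (n : ℕ) :
    Measurable fun t => -(κ t * N (F n t)) + K n t :=
  ((h.measurable_κ.mul (h.continuous_N.comp (h.continuous_F n)).measurable).neg).add
    (h.measurable_K n)

theorem intervalIntegrable_σ (h : IsSmallRaySolution T M C σ κ N lam F K) (a b : ℝ) :
    IntervalIntegrable σ volume a b :=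
  (intervalIntegrable_const (c := M)).mono_fun' h.measurable_σ.aestronglyMeasurable
    (ae_of_all _ h.σ_le)

theorem continuous_exp (h : IsSmallRaySolution T M C σ κ N lam F K) :
    Continuous fun t => Real.exp (∫ s in 0..t, σ s) :=
  (intervalIntegral.continuous_primitive h.intervalIntegrable_σ 0).rexp

theorem exp_le (h : IsSmallRaySolution T M C σ κ N lam F K) {t : ℝ} (ht : t ∈ Icc 0 T) :
    Real.exp (∫ s in 0..t, σ s) ≤ Real.exp (M * T) := by
  have h1 := intervalIntegral.norm_integral_le_of_norm_le_const (a := 0) (b := t) (f := σ) (C := M)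
    fun s _ => h.σ_le s
  rw [sub_zero, abs_of_nonneg ht.1] at h1
  exact Real.exp_le_exp.2 ((le_abs_self _).trans (h1.trans
    (mul_le_mul_of_nonneg_left ht.2 h.nonneg_M)))

theorem duhamel (h : IsSmallRaySolution T M C σ κ N lam F K) (n : ℕ) {t : ℝ} (ht : t ∈ Icc 0 T) :
    F n t * Real.exp (∫ s in 0..t, σ s) = lam n +
      ∫ r in 0..t, (-(κ r * N (F n r)) + K n r) * Real.exp (∫ s in 0..r, σ s) := by
  have h0 : F n 0 = lam n := by
    simpa using h.eq_add_integral n 0 ⟨le_rfl, h.nonneg_T⟩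
  have hsub : ∀ s ∈ Icc 0 t, s ∈ Icc 0 T := fun s hs => ⟨hs.1, hs.2.trans ht.2⟩
  rw [mul_exp_integral_eq h.nonneg_M h.measurable_σ h.σ_le ht.1 (h.continuous_F n)
    (g := fun t => -(κ t * N (F n t)) + K n t) ?_ ?_, h0]
  · refine (intervalIntegrable_const (c := (M * (C * C ^ 2) + C) * lam n ^ 2)).mono_fun'
      (h.measurable_source n).aestronglyMeasurable ?_
    rw [uIoc_of_le ht.1]
    filter_upwards [ae_restrict_mem measurableSet_Ioc] with s hs
    exact h.abs_source_le n (hsub s ⟨hs.1.le, hs.2⟩)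
  · intro s hs
    rw [h0]
    exact h.eq_add_integral n s (hsub s hs)

/-- The Duhamel source is O(λ²), hence O(λ) after division by λ. -/
theorem tendsto_div (h : IsSmallRaySolution T M C σ κ N lam F K) {t : ℝ} (ht : t ∈ Icc 0 T) :
    Tendsto (fun n => F n t / lam n) atTop (𝓝 (Real.exp (-∫ s in 0..t, σ s))) := by
  set D := (M * (C * C ^ 2) + C) * Real.exp (M * T) * T with hD
  have hM := h.nonneg_M
  have hC := h.nonneg_C
  have hT := h.nonneg_T
  have hbound : ∀ n, |F n t * Real.exp (∫ s in 0..t, σ s) / lam n - 1| ≤ D * lam n := by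
    intro n
    have hl := h.lam_pos n
    have h1 : ‖∫ r in 0..t, (-(κ r * N (F n r)) + K n r) * Real.exp (∫ s in 0..r, σ s)‖ ≤
        ((M * (C * C ^ 2) + C) * lam n ^ 2 * Real.exp (M * T)) * |t - 0| := by
      refine intervalIntegral.norm_integral_le_of_norm_le_const fun r hr => ?_
      rw [uIoc_of_le ht.1] at hr
      have hr' : r ∈ Icc 0 T := ⟨hr.1.le, hr.2.trans ht.2⟩
      rw [norm_mul, Real.norm_eq_abs, Real.norm_eq_abs, Real.abs_exp]
      exact mul_le_mul (h.abs_source_le n hr') (h.exp_le hr') (Real.exp_pos _).le (by positivity)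
    have h2 : F n t * Real.exp (∫ s in 0..t, σ s) / lam n - 1 =
        (∫ r in 0..t, (-(κ r * N (F n r)) + K n r) * Real.exp (∫ s in 0..r, σ s)) / lam n := by
      rw [h.duhamel n ht]
      field_simp
      ring
    rw [h2, abs_div, abs_of_pos hl, div_le_iff₀ hl]
    refine h1.trans ?_
    rw [sub_zero, abs_of_nonneg ht.1]
    calc _ ≤ ((M * (C * C ^ 2) + C) * lam n ^ 2 * Real.exp (M * T)) * T := by
          gcongr; exact ht.2
      _ = _ := by rw [hD]; ring
  have h1 : Tendsto (fun n => F n t * Real.exp (∫ s in 0..t, σ s) / lam n) atTop (𝓝 1) := by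
    rw [tendsto_iff_norm_sub_tendsto_zero]
    refine squeeze_zero (fun _ => norm_nonneg _) hbound ?_
    simpa using h.lam_tendsto.const_mul D
  have h2 := h1.mul_const (Real.exp (-∫ s in 0..t, σ s))
  rw [one_mul] at h2
  refine h2.congr fun n => ?_
  rw [Real.exp_neg]
  have := (Real.exp_pos (∫ s in 0..t, σ s)).ne'
  field_simp

/-- In Duhamel's formula divided by λ², N(F)/λ² tends to α exp(-2∫σ) and K/λ² tends to 0. The
integrating factor cancels one of the two attenuations, and dominated convergence passes to the
limit. -/
theorem tendsto_second_order (h : IsSmallRaySolution T M C σ κ N lam F K) {α : ℝ}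
    (hα : (fun a => N a - α * a ^ 2) =o[𝓝 0] fun a => a ^ 2) :
    Tendsto (fun n => (F n T * Real.exp (∫ s in 0..T, σ s) - lam n) / lam n ^ 2) atTop
      (𝓝 (-(α * ∫ t in 0..T, κ t * Real.exp (-∫ s in 0..t, σ s)))) := by
  have hM := h.nonneg_M
  have hC := h.nonneg_C
  have hT := h.nonneg_T
  have heq : ∀ n, (F n T * Real.exp (∫ s in 0..T, σ s) - lam n) / lam n ^ 2 =
      ∫ t in 0..T, (-(κ t * N (F n t)) + K n t) / lam n ^ 2 * Real.exp (∫ s in 0..t, σ s) := by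
    intro n
    rw [h.duhamel n ⟨hT, le_rfl⟩, add_sub_cancel_left, ← intervalIntegral.integral_div]
    simp only [div_mul_eq_mul_div]
  have hlim : -(α * ∫ t in 0..T, κ t * Real.exp (-∫ s in 0..t, σ s)) =
      ∫ t in 0..T, -(α * (κ t * Real.exp (-∫ s in 0..t, σ s))) := by
    rw [intervalIntegral.integral_neg, intervalIntegral.integral_const_mul]
  rw [hlim]
  simp only [heq]
  refine intervalIntegral.tendsto_integral_filter_of_dominated_convergence
    (fun _ => (M * (C * C ^ 2) + C) * Real.exp (M * T)) ?_ ?_ intervalIntegrable_const ?_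
  · refine Eventually.of_forall fun n => ?_
    exact (((h.measurable_source n).div_const _).mul
      h.continuous_exp.measurable).aestronglyMeasurable
  · refine Eventually.of_forall fun n => ae_of_all _ fun t ht => ?_
    rw [uIoc_of_le hT] at ht
    have ht' : t ∈ Icc 0 T := ⟨ht.1.le, ht.2⟩
    have hl := h.lam_pos n
    rw [norm_mul, norm_div, Real.norm_eq_abs, Real.norm_eq_abs, Real.norm_eq_abs, Real.abs_exp,
      abs_of_pos (by positivity : 0 < lam n ^ 2)]
    refine mul_le_mul ?_ (h.exp_le ht') (Real.exp_pos _).le (by positivity)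
    rw [div_le_iff₀ (by positivity)]
    exact h.abs_source_le n ht'
  · refine ae_of_all _ fun t ht => ?_
    rw [uIoc_of_le hT] at ht
    have ht' : t ∈ Icc 0 T := ⟨ht.1.le, ht.2⟩
    have hdiv := h.tendsto_div ht'
    have hF0 : Tendsto (fun n => F n t) atTop (𝓝 0) := by
      have := hdiv.mul h.lam_tendsto
      rw [mul_zero] at this
      refine this.congr fun n => ?_
      have := (h.lam_pos n).ne'
      field_simp
    have hO : (fun n => F n t ^ 2) =O[atTop] fun n => lam n ^ 2 := by
      refine Asymptotics.IsBigO.pow ?_ 2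
      refine Asymptotics.IsBigO.of_bound C (Eventually.of_forall fun n => ?_)
      rw [Real.norm_eq_abs, Real.norm_eq_abs, abs_of_pos (h.lam_pos n)]
      exact h.F_le n t ht'
    have h1 := ((hα.comp_tendsto hF0).trans_isBigO hO).tendsto_div_nhds_zero
    have h2 : Tendsto (fun n => K n t / lam n ^ 2) atTop (𝓝 0) := by
      refine squeeze_zero_norm (a := fun n => C * lam n) (fun n => ?_)
        (by simpa using h.lam_tendsto.const_mul C)
      have hl := h.lam_pos n
      rw [norm_div, Real.norm_eq_abs, Real.norm_eq_abs, abs_of_pos (by positivity : 0 < lam n ^ 2),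
        div_le_iff₀ (by positivity)]
      refine (h.K_le n t ht').trans_eq ?_
      ring
    have h3 := ((((h1.add ((hdiv.pow 2).const_mul α)).const_mul (κ t)).neg.add h2).mul_const
      (Real.exp (∫ s in 0..t, σ s)))
    have hval : (-(κ t * (0 + α * Real.exp (-∫ s in 0..t, σ s) ^ 2)) + 0) *
        Real.exp (∫ s in 0..t, σ s) = -(α * (κ t * Real.exp (-∫ s in 0..t, σ s))) := by
      rw [Real.exp_neg]
      have := (Real.exp_pos (∫ s in 0..t, σ s)).ne'
      field_simp
      ring
    rw [hval] at h3
    refine h3.congr fun n => ?_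
    have := (h.lam_pos n).ne'
    simp only [Function.comp_apply]
    field_simp
    ring

end IsSmallRaySolution

end NonlinearTransport

namespace NonlinearTransport

/-! ### Truncation of the nonlinearity -/

/-- The nonlinearity `N₀`, made constant outside `[-1, 1]`. -/
noncomputable def truncate (N₀ : ℝ → ℝ) (a : ℝ) : ℝ := N₀ (max (-1) (min a 1))

section Truncate

variable {N₀ : ℝ → ℝ} {C₁ C₂ : ℝ} {l : ℕ}

theorem clamp_eq_self {a : ℝ} (ha : |a| ≤ 1) : max (-1) (min a 1) = a := by
  rw [abs_le] at ha
  rw [min_eq_left ha.2, max_eq_right ha.1]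

theorem clamp_mem_Icc (a : ℝ) : max (-1) (min a 1) ∈ Icc (-1 : ℝ) 1 :=
  ⟨le_max_left _ _, max_le (by norm_num) (min_le_right _ _)⟩

theorem abs_clamp_le (a : ℝ) : |max (-1) (min a 1)| ≤ |a| := by
  rw [abs_le]
  constructor
  · rcases le_total a 1 with h | h
    · rw [min_eq_left h]; exact (neg_abs_le a).trans (le_max_right _ _)
    · rw [min_eq_right h]
      exact (neg_nonpos.2 (abs_nonneg a)).trans (le_max_of_le_right zero_le_one)
  · rcases le_total a 1 with h | h
    · rw [min_eq_left h]
      refine max_le ?_ (le_abs_self a)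
      linarith [abs_nonneg a]
    · rw [min_eq_right h]
      exact max_le (by linarith [abs_nonneg a]) (h.trans (le_abs_self a))

theorem abs_clamp_sub_le (a b : ℝ) : |max (-1) (min a 1) - max (-1) (min b 1)| ≤ |a - b| := by
  have h : LipschitzWith 1 fun a : ℝ => max (-1) (min a 1) :=
    (LipschitzWith.id.min_const 1).const_max (-1)
  simpa [Real.dist_eq] using h.dist_le_mul a b

theorem truncate_eq {a : ℝ} (ha : |a| ≤ 1) : truncate N₀ a = N₀ a := by
  rw [truncate, clamp_eq_self ha]

theorem abs_truncate_le (hl : 2 ≤ l) (hC₁ : 0 < C₁) (hN₀ : ∀ y, |N₀ y| ≤ C₁ * |y| ^ l) (a : ℝ) :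
    |truncate N₀ a| ≤ C₁ * a ^ 2 := by
  refine (hN₀ _).trans (mul_le_mul_of_nonneg_left ?_ hC₁.le)
  refine (pow_le_pow_of_le_one (abs_nonneg _) (abs_le.2 (clamp_mem_Icc a)) hl).trans ?_
  rw [← sq_abs a]
  exact pow_le_pow_left₀ (abs_nonneg _) (abs_clamp_le a) 2

theorem truncate_lipschitz (hC₂ : 0 < C₂) (hN₀_diff : Differentiable ℝ N₀)
    (hN₀_deriv : ∀ y, |deriv N₀ y| ≤ C₂ * |y| ^ (l - 1)) (a b : ℝ) :
    |truncate N₀ a - truncate N₀ b| ≤ C₂ * |a - b| := by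
  have h := (convex_Icc (-1 : ℝ) 1).norm_image_sub_le_of_norm_deriv_le (f := N₀) (C := C₂)
    (fun x _ => hN₀_diff x) (fun x hx => (hN₀_deriv x).trans
      (mul_le_of_le_one_right hC₂.le (pow_le_one₀ (abs_nonneg _) (abs_le.2 hx))))
    (clamp_mem_Icc b) (clamp_mem_Icc a)
  exact h.trans (mul_le_mul_of_nonneg_left (abs_clamp_sub_le a b) hC₂.le)

/-- Second-order Taylor expansion when the second derivative exists only at 0: the derivative of
f(x) - αx²/2, with α = f''(0), is o(x), and the mean value inequality on [-|a|, |a|] integrates this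
bound. -/
theorem isLittleO_sub_half_deriv_deriv {f : ℝ → ℝ} (hf : Differentiable ℝ f) (h0 : f 0 = 0)
    (h1 : deriv f 0 = 0) (h2 : DifferentiableAt ℝ (deriv f) 0) :
    (fun a => f a - deriv (deriv f) 0 / 2 * a ^ 2) =o[𝓝 0] fun a => a ^ 2 := by
  set α := deriv (deriv f) 0 with hα
  have hd : (fun x => deriv f x - α * x) =o[𝓝 0] fun x => x := by
    have := h2.hasDerivAt.isLittleO
    simpa [h1, mul_comm] using this
  refine Asymptotics.isLittleO_iff.2 fun ε hε => ?_
  obtain ⟨r, hr, hball⟩ := Metric.eventually_nhds_iff_ball.1 (Asymptotics.isLittleO_iff.1 hd hε)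
  filter_upwards [Metric.ball_mem_nhds (0 : ℝ) hr] with a ha
  rw [Metric.mem_ball, Real.dist_eq, sub_zero] at ha
  have hder : ∀ x, HasDerivAt (fun x => f x - α / 2 * x ^ 2) (deriv f x - α * x) x := fun x => by
    have := (hf x).hasDerivAt.sub (((hasDerivAt_id x).pow 2).const_mul (α / 2))
    convert! this using 1
    simp
    ring
  have hmv := (convex_Icc (-|a|) |a|).norm_image_sub_le_of_norm_hasDerivWithin_le
    (C := ε * |a|) (fun x _ => (hder x).hasDerivWithinAt) (fun x hx => ?_)
    (x := 0) (y := a) (by simp) ⟨neg_abs_le a, le_abs_self a⟩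
  · simp only [h0] at hmv
    norm_num at hmv
    rw [Real.norm_eq_abs, Real.norm_eq_abs, abs_pow]
    linarith
  · have hx' : |x| ≤ |a| := abs_le.2 hx
    have := hball x (by rw [Metric.mem_ball, Real.dist_eq, sub_zero]; exact hx'.trans_lt ha)
    exact this.trans (mul_le_mul_of_nonneg_left hx' hε.le)

theorem isLittleO_truncate (hl : 2 ≤ l) (hN₀ : ∀ y, |N₀ y| ≤ C₁ * |y| ^ l)
    (hN₀_diff : Differentiable ℝ N₀) (hN₀_deriv : ∀ y, |deriv N₀ y| ≤ C₂ * |y| ^ (l - 1))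
    (hN₀_diff₂ : DifferentiableAt ℝ (deriv N₀) 0) :
    (fun a => truncate N₀ a - deriv (deriv N₀) 0 / 2 * a ^ 2) =o[𝓝 0] fun a => a ^ 2 := by
  have h0 : N₀ 0 = 0 := by
    have := hN₀ 0
    rw [abs_zero, zero_pow (by omega), mul_zero] at this
    exact abs_nonpos_iff.1 this
  have h1 : deriv N₀ 0 = 0 := by
    have := hN₀_deriv 0
    rw [abs_zero, zero_pow (by omega), mul_zero] at this
    exact abs_nonpos_iff.1 this
  refine (isLittleO_sub_half_deriv_deriv hN₀_diff h0 h1 hN₀_diff₂).congr' ?_ EventuallyEq.rfl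
  filter_upwards [Metric.ball_mem_nhds (0 : ℝ) one_pos] with a ha
  rw [Metric.mem_ball, Real.dist_eq, sub_zero] at ha
  rw [truncate_eq ha.le]

end Truncate

/-! ### Data localized in velocity -/

variable {d : ℕ}

/-- The balls decrease to a null point. The radius is doubled so that a ball of radius 1/(m+1) about
a nearby dense point fits inside. -/
theorem exists_closedBall_sphereMeasure_le (hd : 2 ≤ d) (v : Velocity d) {ε : ℝ} (hε : 0 < ε) :
    ∃ m : ℕ, (sphereMeasure d).real (Metric.closedBall v (2 / ((m : ℝ) + 1))) ≤ ε := by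
  have hanti : Antitone fun m : ℕ => Metric.closedBall v (2 / ((m : ℝ) + 1)) := fun a b hab =>
    Metric.closedBall_subset_closedBall (by gcongr)
  have hinter : ⋂ m : ℕ, Metric.closedBall v (2 / ((m : ℝ) + 1)) = {v} := by
    ext x
    simp only [mem_iInter, Metric.mem_closedBall, mem_singleton_iff]
    refine ⟨fun h => ?_, fun h m => by rw [h, dist_self]; positivity⟩
    have hlim : Tendsto (fun m : ℕ => 2 / ((m : ℝ) + 1)) atTop (𝓝 0) := by
      have := (tendsto_one_div_add_atTop_nhds_zero_nat (𝕜 := ℝ)).const_mul 2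
      simpa [div_eq_mul_inv] using this
    exact dist_le_zero.1 (ge_of_tendsto' hlim h)
  have h := tendsto_measure_iInter_atTop (μ := sphereMeasure d)
    (fun m : ℕ => (Metric.isClosed_closedBall (x := v)
      (ε := 2 / ((m : ℝ) + 1))).measurableSet.nullMeasurableSet) hanti
    ⟨0, measure_ne_top _ _⟩
  rw [hinter, sphereMeasure_singleton hd] at h
  obtain ⟨m, hm⟩ := (h.eventually (ge_mem_nhds (ENNReal.ofReal_pos.2 hε))).exists
  exact ⟨m, ENNReal.toReal_le_of_le_ofReal hε.le hm⟩

/-- The initial datum equal to `c` on `Ω × B` and to zero elsewhere. -/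
noncomputable def localizedDatum (Ω : Set (Space d)) (B : Set (Velocity d)) (c : ℝ) :
    Space d × Velocity d → ℝ :=
  (Ω ×ˢ B).indicator fun _ => c

/-- The weight `1_B + ω(B)`, which controls the solution with initial datum supported in `B`. -/
noncomputable def velocityWeight (B : Set (Velocity d)) (v : Velocity d) : ℝ :=
  B.indicator (fun _ => 1) v + (sphereMeasure d).real B

theorem velocityWeight_nonneg (B : Set (Velocity d)) (v : Velocity d) : 0 ≤ velocityWeight B v :=
  add_nonneg (indicator_nonneg (fun _ _ => zero_le_one) v) measureReal_nonneg

theorem velocityWeight_le_two (hd : 2 ≤ d) (B : Set (Velocity d)) (v : Velocity d) :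
    velocityWeight B v ≤ 2 := by
  have := isProbabilityMeasure_sphereMeasure hd
  have h1 : B.indicator (fun _ => (1 : ℝ)) v ≤ 1 := indicator_le' (fun _ _ => le_rfl)
    (fun _ _ => zero_le_one) v
  have h2 : (sphereMeasure d).real B ≤ 1 := measureReal_le_one
  rw [velocityWeight]
  linarith

theorem measurable_velocityWeight {B : Set (Velocity d)} (hB : MeasurableSet B) :
    Measurable (velocityWeight B) :=
  (measurable_const.indicator hB).add measurable_const

theorem integrable_velocityWeight (hd : 2 ≤ d) {B : Set (Velocity d)} (hB : MeasurableSet B) :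
    Integrable (velocityWeight B) (sphereMeasure d) :=
  Integrable.of_bound (measurable_velocityWeight hB).aestronglyMeasurable 2
    (ae_of_all _ fun v => by
      rw [Real.norm_eq_abs, abs_of_nonneg (velocityWeight_nonneg B v)]
      exact velocityWeight_le_two hd B v)

theorem integral_velocityWeight (hd : 2 ≤ d) {B : Set (Velocity d)} (hB : MeasurableSet B) :
    ∫ v, velocityWeight B v ∂(sphereMeasure d) = 2 * (sphereMeasure d).real B := by
  have := isProbabilityMeasure_sphereMeasure hd
  simp only [velocityWeight]
  rw [integral_add ((integrable_const (1 : ℝ)).indicator hB) (integrable_const _),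
    integral_indicator_const _ hB, integral_const, probReal_univ]
  simp only [smul_eq_mul]
  ring

variable {Ω : Set (Space d)} {M T C₁ : ℝ} {σ q : Space d × Velocity d → ℝ}
  {k : Space d × Velocity d × Velocity d → ℝ} {N : ℝ → ℝ}

/-- The amplification of initial data on the time interval `[0, T]`. -/
noncomputable def growth (M T : ℝ) : ℝ := 2 * Real.exp (2 * (3 * M + M * M + 1) * T)

theorem growth_pos (M T : ℝ) : 0 < growth M T := by
  unfold growth
  positivity

/-- The weight c(1_B + ω(B)) has mean 2cω(B), at most twice its value at any velocity, which is
exactly what the Picard argument asks of a weight. -/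
theorem IsRegular.exists_localized_solution (hr : IsRegular Ω M σ q k N) (hd : 2 ≤ d)
    (hΩ : IsOpen Ω) {B : Set (Velocity d)} (hB : MeasurableSet B) {c : ℝ} (hc : 0 ≤ c) :
    ∃ F, IsCharSolution σ q k N (localizedDatum Ω B c) F ∧
      ∀ z, ∀ t ∈ Icc 0 T, |F (z, t)| ≤ growth M T * c * velocityWeight B z.2 := by
  have hM := hr.nonneg
  have hmeas : (0 : ℝ) ≤ (sphereMeasure d).real B := measureReal_nonneg
  obtain ⟨F, hF, hb⟩ := hr.exists_isCharSolution (w := fun v => c * velocityWeight B v)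
    (W₀ := c * 2) (h := localizedDatum Ω B c)
    ((measurable_velocityWeight hB).const_mul c)
    (fun v => mul_nonneg hc (velocityWeight_nonneg B v))
    (fun v => mul_le_mul_of_nonneg_left (velocityWeight_le_two hd B v) hc)
    (fun v => by
      rw [integral_const_mul, integral_velocityWeight hd hB]
      have h1 : 0 ≤ B.indicator (fun _ => (1 : ℝ)) v := indicator_nonneg (fun _ _ => zero_le_one) v
      rw [mul_left_comm]
      refine mul_le_mul_of_nonneg_left (mul_le_mul_of_nonneg_left ?_ hc) zero_le_two
      rw [velocityWeight]
      linarith)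
    (measurable_const.indicator (hΩ.measurableSet.prod hB))
    (fun z => by
      by_cases hz : z ∈ Ω ×ˢ B
      · rw [localizedDatum, indicator_of_mem hz, velocityWeight, indicator_of_mem hz.2,
          abs_of_nonneg hc]
        nlinarith
      · rw [localizedDatum, indicator_of_notMem hz, abs_zero]
        exact mul_nonneg hc (velocityWeight_nonneg B _))
  refine ⟨F, hF, fun z t ht => (hb z t).trans ?_⟩
  rw [abs_of_nonneg ht.1, growth, mul_assoc (2 * _)]
  have := velocityWeight_nonneg B z.2
  have := ht.2
  gcongr

/-- Scattering is at most M times the mean of the bound on F, a multiple of λω(B); the choice ω(B) ≤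
λ² pushes it below the quadratic term of the nonlinearity. -/
theorem isSmallRaySolution_of_localized (hr : IsRegular Ω M σ q k N) (hd : 2 ≤ d) (hT : 0 ≤ T)
    (hC₁ : 0 ≤ C₁) (hN : ∀ a, |N a| ≤ C₁ * a ^ 2)
    {lam : ℕ → ℝ} (hlam : ∀ n, 0 < lam n) (hlam1 : ∀ n, lam n ≤ 1)
    (hlam0 : Tendsto lam atTop (𝓝 0))
    {B : ℕ → Set (Velocity d)} (hB : ∀ n, MeasurableSet (B n))
    (hBlam : ∀ n, (sphereMeasure d).real (B n) ≤ lam n ^ 2)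
    {F : ℕ → (Space d × Velocity d) × ℝ → ℝ}
    (hF : ∀ n, IsCharSolution σ q k N (localizedDatum Ω (B n) (lam n)) (F n))
    (hb : ∀ n z, ∀ t ∈ Icc 0 T, |F n (z, t)| ≤ growth M T * lam n * velocityWeight (B n) z.2)
    {z : Space d × Velocity d} (hz : z.1 ∈ Ω) (hzB : ∀ n, z.2 ∈ B n) :
    IsSmallRaySolution T M (2 * growth M T + C₁ + 2 * M * growth M T)
      (fun s => σ (z.1 + s • (z.2 : Space d), z.2)) (fun s => q (z.1 + s • (z.2 : Space d), z.2)) N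
      lam (fun n t => F n (z, t)) (fun n t => charScattering k (F n) (z, t)) := by
  have hM := hr.nonneg
  have hg := growth_pos M T
  have hline : Measurable fun s : ℝ => (z.1 + s • (z.2 : Space d), z.2) := by fun_prop
  refine ⟨hT, hM, by positivity, hr.measurable_σ.comp hline, hr.measurable_q.comp hline,
    hr.continuous_N, fun t => hr.σ_le _, fun t => hr.q_le _, fun a => (hN a).trans ?_, hlam, hlam1,
    hlam0, fun n => (hF n).continuous z, fun n =>
      (measurable_charScattering hr.measurable_k (hF n).measurable).comp measurable_prodMk_left,
    fun n t ht => (hb n z t ht).trans ?_, fun n t ht => ?_, fun n t ht => ?_⟩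
  · have : 0 ≤ 2 * growth M T + 2 * M * growth M T := by positivity
    refine mul_le_mul_of_nonneg_right ?_ (sq_nonneg a)
    linarith
  · have h1 := velocityWeight_le_two hd (B n) z.2
    have h2 : 0 ≤ growth M T * lam n := mul_nonneg hg.le (hlam n).le
    have h3 : 0 ≤ (C₁ + 2 * M * growth M T) * lam n := mul_nonneg (by positivity) (hlam n).le
    nlinarith
  · have h1 := abs_charScattering_le hM hr.k_le (w := velocityWeight (B n))
      (integrable_velocityWeight hd (hB n)) (F := F n) (m := growth M T * lam n) (p := (z, t))
      (fun z => hb n z t ht)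
    rw [integral_velocityWeight hd (hB n)] at h1
    refine h1.trans ?_
    have hl := (hlam n).le
    calc M * (growth M T * lam n * (2 * (sphereMeasure d).real (B n)))
        ≤ M * (growth M T * lam n * (2 * lam n ^ 2)) := by gcongr; exact hBlam n
      _ = 2 * M * growth M T * lam n ^ 3 := by ring
      _ ≤ _ := by
        refine mul_le_mul_of_nonneg_right ?_ (by positivity)
        linarith
  · rw [(hF n).eq_add_integral z t ht.1, localizedDatum,
      indicator_of_mem (mem_prod.2 ⟨hz, hzB n⟩)]
    congr 1
    refine intervalIntegral.integral_congr fun s _ => ?_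
    simp only [collision]
    ring

end NonlinearTransport

namespace NonlinearTransport

/-! ### Identification of the coefficients -/

theorem IsSmallRaySolution.integral_absorption_eq {T M C : ℝ} {σ₁ σ₂ κ₁ κ₂ N : ℝ → ℝ} {lam : ℕ → ℝ}
    {F₁ F₂ K₁ K₂ : ℕ → ℝ → ℝ} (h₁ : IsSmallRaySolution T M C σ₁ κ₁ N lam F₁ K₁)
    (h₂ : IsSmallRaySolution T M C σ₂ κ₂ N lam F₂ K₂) (hF : ∀ n, F₁ n T = F₂ n T) :
    ∫ s in 0..T, σ₁ s = ∫ s in 0..T, σ₂ s := by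
  have h := h₁.tendsto_div ⟨h₁.nonneg_T, le_rfl⟩
  simp only [hF] at h
  exact neg_injective (Real.exp_injective
    (tendsto_nhds_unique h (h₂.tendsto_div ⟨h₁.nonneg_T, le_rfl⟩)))

theorem IsSmallRaySolution.attenuated_integral_eq {T M C : ℝ} {σ κ₁ κ₂ N : ℝ → ℝ} {lam : ℕ → ℝ}
    {F₁ F₂ K₁ K₂ : ℕ → ℝ → ℝ} (h₁ : IsSmallRaySolution T M C σ κ₁ N lam F₁ K₁)
    (h₂ : IsSmallRaySolution T M C σ κ₂ N lam F₂ K₂) (hF : ∀ n, F₁ n T = F₂ n T) {α : ℝ}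
    (hα : (fun a => N a - α * a ^ 2) =o[𝓝 0] fun a => a ^ 2) (hα0 : α ≠ 0) :
    ∫ t in 0..T, κ₁ t * Real.exp (-∫ s in 0..t, σ s) =
      ∫ t in 0..T, κ₂ t * Real.exp (-∫ s in 0..t, σ s) := by
  have h := h₁.tendsto_second_order hα
  simp only [hF] at h
  exact mul_left_cancel₀ hα0 (neg_injective
    (tendsto_nhds_unique h (h₂.tendsto_second_order hα)))

variable {d : ℕ} {Ω : Set (Space d)}

theorem measurable_localizedDatum (hΩ : IsOpen Ω) {B : Set (Velocity d)} (hB : MeasurableSet B)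
    (c : ℝ) : Measurable (localizedDatum Ω B c) :=
  measurable_const.indicator (hΩ.measurableSet.prod hB)

theorem abs_localizedDatum_le {B : Set (Velocity d)} {c : ℝ} (hc : 0 ≤ c)
    (z : Space d × Velocity d) : |localizedDatum Ω B c z| ≤ c := by
  by_cases hz : z ∈ Ω ×ˢ B
  · rw [localizedDatum, indicator_of_mem hz, abs_of_nonneg hc]
  · rwa [localizedDatum, indicator_of_notMem hz, abs_zero]

/-- If two sets of coefficients lead to the same measurements for small data, then along almost
every ray there are solutions with small data of the two reduced equations which have the same
final values. -/
theorem ae_exists_isSmallRaySolution (hd : 2 ≤ d) (hΩ : IsOpen Ω)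
    (hΩb : Bornology.IsBounded Ω) (hΩc : Convex ℝ Ω) (hΩs : HasSmoothBoundary Ω)
    {T : ℝ} (hT : Metric.diam Ω < T) {σ₁ σ₂ q₁ q₂ τ₁ τ₂ p₁ p₂ : Space d × Velocity d → ℝ}
    {μ k : Space d × Velocity d × Velocity d → ℝ} {N₀ N : ℝ → ℝ} {M C₁ δ : ℝ}
    (hr₁ : IsRegular Ω M τ₁ p₁ k N) (hr₂ : IsRegular Ω M τ₂ p₂ k N)
    (hσ₁ : σ₁ =ᵐ[phaseMeasure Ω] τ₁) (hσ₂ : σ₂ =ᵐ[phaseMeasure Ω] τ₂)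
    (hq₁ : q₁ =ᵐ[phaseMeasure Ω] p₁) (hq₂ : q₂ =ᵐ[phaseMeasure Ω] p₂)
    (hμ : μ =ᵐ[phaseMeasure₂ Ω] k) (hC₁ : 0 ≤ C₁) (hN : ∀ a, |N a| ≤ C₁ * a ^ 2)
    (hN₀ : ∀ a, |a| ≤ 1 → N₀ a = N a) (hδ : 0 < δ)
    (hA : ∀ h : Space d × Velocity d → ℝ, MemLp h ⊤ (phaseMeasure Ω) →
      eLpNorm h ⊤ (phaseMeasure Ω) ≤ ENNReal.ofReal δ →
      ∀ g₁ g₂ : (Space d × Velocity d) × ℝ → ℝ,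
        IsMeasurement Ω T σ₁ μ (fun z y => q₁ z * N₀ y) h (fun _ => 0) g₁ →
        IsMeasurement Ω T σ₂ μ (fun z y => q₂ z * N₀ y) h (fun _ => 0) g₂ →
        g₁ =ᵐ[boundaryTimeMeasure Ω (outgoing Ω) T] g₂) :
    ∀ᵐ z ∂(phaseMeasure Ω), ∃ (C : ℝ) (lam : ℕ → ℝ) (F₁ F₂ K₁ K₂ : ℕ → ℝ → ℝ),
      IsSmallRaySolution T M C (fun s => τ₁ (z.1 + s • (z.2 : Space d), z.2))
        (fun s => p₁ (z.1 + s • (z.2 : Space d), z.2)) N lam F₁ K₁ ∧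
      IsSmallRaySolution T M C (fun s => τ₂ (z.1 + s • (z.2 : Space d), z.2))
        (fun s => p₂ (z.1 + s • (z.2 : Space d), z.2)) N lam F₂ K₂ ∧
      ∀ n, F₁ n T = F₂ n T := by
  have hT0 : 0 ≤ T := Metric.diam_nonneg.trans hT.le
  have hg := growth_pos M T
  have hfin := isFiniteMeasure_phaseMeasure hΩb
  have : Nonempty (Velocity d) := by
    have := isProbabilityMeasure_sphereMeasure hd
    exact nonempty_of_isProbabilityMeasure (sphereMeasure d)
  -- The three bounds keep λ ≤ 1, the datum within δ, and, as the weight is at most 2, the solution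
  -- within [-1, 1].
  set c₀ : ℝ := min 1 (min δ (1 / (2 * growth M T))) with hc₀
  have hc₀pos : 0 < c₀ := lt_min one_pos (lt_min hδ (by positivity))
  set lam : ℕ → ℝ := fun n => c₀ * (1 / ((n : ℝ) + 1)) with hlam
  have hlampos : ∀ n, 0 < lam n := fun n => by positivity
  have hlamle : ∀ n, lam n ≤ c₀ := fun n => by
    refine mul_le_of_le_one_right hc₀pos.le ?_
    rw [div_le_one (by positivity)]
    linarith [(Nat.cast_nonneg n : (0 : ℝ) ≤ n)]
  have hlam0 : Tendsto lam atTop (𝓝 0) := by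
    simpa [hlam] using (tendsto_one_div_add_atTop_nhds_zero_nat (𝕜 := ℝ)).const_mul c₀
  -- A countable family of balls, so that the exceptional null sets of all the data can be united
  -- before a velocity is fixed.
  set B : ℕ → ℕ → Set (Velocity d) := fun i m =>
    Metric.ball (TopologicalSpace.denseSeq (Velocity d) i) (1 / ((m : ℝ) + 1)) with hBdef
  have hB : ∀ i m, MeasurableSet (B i m) := fun i m => Metric.isOpen_ball.measurableSet
  choose F₁ hF₁ hb₁ using fun n i m =>
    hr₁.exists_localized_solution (T := T) hd hΩ (hB i m) (hlampos n).le
  choose F₂ hF₂ hb₂ using fun n i m =>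
    hr₂.exists_localized_solution (T := T) hd hΩ (hB i m) (hlampos n).le
  have hsmall : ∀ n (B : Set (Velocity d)) (v : Velocity d),
      growth M T * lam n * velocityWeight B v ≤ 1 := fun n B v => by
    have h1 : lam n ≤ 1 / (2 * growth M T) :=
      (hlamle n).trans ((min_le_right _ _).trans (min_le_right _ _))
    rw [le_div_iff₀ (by positivity)] at h1
    have h2 := velocityWeight_le_two hd B v
    have h3 : 0 ≤ growth M T * lam n := mul_nonneg hg.le (hlampos n).le
    nlinarith
  have hfinal : ∀ n i m, ∀ᵐ z ∂(phaseMeasure Ω), F₁ n i m (z, T) = F₂ n i m (z, T) := by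
    intro n i m
    have hbound := abs_localizedDatum_le (Ω := Ω) (B := B i m) (hlampos n).le
    have hout : ∀ z : Space d × Velocity d, z.1 ∉ Ω → localizedDatum Ω (B i m) (lam n) z = 0 :=
      fun z hz => indicator_of_notMem (fun h => hz h.1) _
    refine ae_final_eq_of_ae_outgoing hd hΩ hΩb hΩc hΩs hT hr₁ hr₂ (hF₁ n i m) (hF₂ n i m)
      (hA (localizedDatum Ω (B i m) (lam n)) ?_ ?_ _ _
        (isMeasurement_physical hd hr₁ hσ₁ hq₁ hμ hΩ hΩb hΩc hT0 hN₀ (hF₁ n i m)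
          (fun z t ht => (hb₁ n i m z t ht).trans (hsmall n _ _)) hout)
        (isMeasurement_physical hd hr₂ hσ₂ hq₂ hμ hΩ hΩb hΩc hT0 hN₀ (hF₂ n i m)
          (fun z t ht => (hb₂ n i m z t ht).trans (hsmall n _ _)) hout))
    · exact MemLp.of_bound (measurable_localizedDatum hΩ (hB i m) _).aestronglyMeasurable (lam n)
        (ae_of_all _ hbound)
    · rw [eLpNorm_exponent_top]
      refine (eLpNormEssSup_le_of_ae_bound (ae_of_all _ hbound)).trans
        (ENNReal.ofReal_le_ofReal ?_)
      exact (hlamle n).trans ((min_le_right _ _).trans (min_le_left _ _))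
  have hall : ∀ᵐ z ∂(phaseMeasure Ω), ∀ n i m, F₁ n i m (z, T) = F₂ n i m (z, T) := by
    simp only [ae_all_iff]
    exact hfinal
  have hmem : ∀ᵐ z ∂(phaseMeasure Ω), z.1 ∈ Ω :=
    Measure.quasiMeasurePreserving_fst.ae (ae_restrict_mem hΩ.measurableSet)
  filter_upwards [hall, hmem] with z hz hzΩ
  choose m hm using fun n =>
    exists_closedBall_sphereMeasure_le hd z.2 (ε := lam n ^ 2) (pow_pos (hlampos n) 2)
  have hdense : ∀ n, ∃ i, dist z.2 (TopologicalSpace.denseSeq (Velocity d) i) <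
      1 / ((m n : ℝ) + 1) := fun n => by
    obtain ⟨_, ⟨i, rfl⟩, hi⟩ := Metric.mem_closure_iff.1
      ((TopologicalSpace.denseRange_denseSeq (Velocity d)) z.2) (1 / ((m n : ℝ) + 1))
      (by positivity)
    exact ⟨i, hi⟩
  choose i hi using hdense
  have hBsub : ∀ n, B (i n) (m n) ⊆ Metric.closedBall z.2 (2 / ((m n : ℝ) + 1)) := fun n x hx => by
    have h1 := hi n
    have h2 : dist x (TopologicalSpace.denseSeq (Velocity d) (i n)) < 1 / ((m n : ℝ) + 1) := hx
    have h3 := dist_triangle_right x z.2 (TopologicalSpace.denseSeq (Velocity d) (i n))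
    have h4 : 2 / ((m n : ℝ) + 1) = 1 / ((m n : ℝ) + 1) + 1 / ((m n : ℝ) + 1) := by ring
    rw [Metric.mem_closedBall]
    linarith
  have hBlam : ∀ n, (sphereMeasure d).real (B (i n) (m n)) ≤ lam n ^ 2 := fun n =>
    (measureReal_mono (hBsub n)).trans (hm n)
  have hlam1 : ∀ n, lam n ≤ 1 := fun n => (hlamle n).trans (min_le_left _ _)
  exact ⟨_, lam, _, _, _, _,
    isSmallRaySolution_of_localized hr₁ hd hT0 hC₁ hN hlampos hlam1 hlam0
      (fun n => hB (i n) (m n)) hBlam (fun n => hF₁ n (i n) (m n))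
      (fun n => hb₁ n (i n) (m n)) hzΩ hi,
    isSmallRaySolution_of_localized hr₂ hd hT0 hC₁ hN hlampos hlam1 hlam0
      (fun n => hB (i n) (m n)) hBlam (fun n => hF₂ n (i n) (m n))
      (fun n => hb₂ n (i n) (m n)) hzΩ hi,
    fun n => hz n (i n) (m n)⟩

end NonlinearTransport

/-! ### Conclusion: absorption first, then the nonlinear coefficient. -/

theorem theorem1p2 (d : ℕ) (hd : 2 ≤ d)
    (Ω : Set (Space d)) (hΩ_open : IsOpen Ω) (hΩ_bdd : Bornology.IsBounded Ω)
    (hΩ_conv : Convex ℝ Ω) (hΩ_smooth : HasSmoothBoundary Ω)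
    (T : ℝ) (hT : Metric.diam Ω < T)
    (γ : Velocity d) (γ₀ : ℝ) (hγ₀ : 0 < γ₀)
    (σ₁ σ₂ q₁ q₂ : Space d × Velocity d → ℝ) (μ : Space d × Velocity d × Velocity d → ℝ)
    (hσ₁ : IsAdmissible Ω σ₁ μ) (hσ₂ : IsAdmissible Ω σ₂ μ)
    (hq₁ : MemLp q₁ ⊤ (phaseMeasure Ω)) (hq₂ : MemLp q₂ ⊤ (phaseMeasure Ω))
    (hσ₁Λ : MemLambda Ω γ γ₀ σ₁) (hσ₂Λ : MemLambda Ω γ γ₀ σ₂)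
    (hq₁Λ : MemLambda Ω γ γ₀ q₁) (hq₂Λ : MemLambda Ω γ γ₀ q₂)
    (hμΛ : ∀ᵐ v ∂(sphereMeasure d), MemLambda Ω γ γ₀ (fun z => μ (z.1, z.2, v)))
    (N₀ : ℝ → ℝ) (l : ℕ) (hl : 2 ≤ l) (C₁ C₂ : ℝ) (hC₁ : 0 < C₁) (hC₂ : 0 < C₂)
    (hN₀_diff : Differentiable ℝ N₀)
    (hN₀ : ∀ y, |N₀ y| ≤ C₁ * |y| ^ l)
    (hN₀_deriv : ∀ y, |deriv N₀ y| ≤ C₂ * |y| ^ (l - 1))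
    (hN₀_diff₂ : DifferentiableAt ℝ (deriv N₀) 0) (hN₀_pos : 0 < deriv (deriv N₀) 0)
    (δ : ℝ) (hδ : 0 < δ)
    (hA : ∀ h : Space d × Velocity d → ℝ, MemLp h ⊤ (phaseMeasure Ω) →
      eLpNorm h ⊤ (phaseMeasure Ω) ≤ ENNReal.ofReal δ →
      ∀ g₁ g₂ : (Space d × Velocity d) × ℝ → ℝ,
        IsMeasurement Ω T σ₁ μ (fun z y => q₁ z * N₀ y) h (fun _ => 0) g₁ →
        IsMeasurement Ω T σ₂ μ (fun z y => q₂ z * N₀ y) h (fun _ => 0) g₂ →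
        g₁ =ᵐ[boundaryTimeMeasure Ω (outgoing Ω) T] g₂) :
    σ₁ =ᵐ[phaseMeasure Ω] σ₂ ∧ q₁ =ᵐ[phaseMeasure Ω] q₂ ∧
      ∀ᵐ z ∂(phaseMeasure Ω), ∀ y : ℝ, q₁ z * N₀ y = q₂ z * N₀ y := by
  obtain ⟨τ₁, M₁, hτ₁m, hM₁, hτ₁, hτ₁0, hστ₁⟩ :=
    exists_bounded_representative hΩ_open.measurableSet hσ₁.memLp_absorption
  obtain ⟨τ₂, M₂, hτ₂m, hM₂, hτ₂, hτ₂0, hστ₂⟩ :=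
    exists_bounded_representative hΩ_open.measurableSet hσ₂.memLp_absorption
  obtain ⟨p₁, M₃, hp₁m, hM₃, hp₁, hp₁0, hqp₁⟩ :=
    exists_bounded_representative hΩ_open.measurableSet hq₁
  obtain ⟨p₂, M₄, hp₂m, hM₄, hp₂, hp₂0, hqp₂⟩ :=
    exists_bounded_representative hΩ_open.measurableSet hq₂
  obtain ⟨k, M₅, hkm, hM₅, hk, hk0, hμk⟩ :=
    exists_bounded_representative hΩ_open.measurableSet hσ₁.memLp_scattering
  set M := M₁ + M₂ + M₃ + M₄ + M₅ + C₂ with hM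
  have hN0 : truncate N₀ 0 = 0 := by
    have := abs_truncate_le hl hC₁ hN₀ 0
    rw [zero_pow two_ne_zero, mul_zero] at this
    exact abs_nonpos_iff.1 this
  have hreg : ∀ τ p : Space d × Velocity d → ℝ, Measurable τ → Measurable p →
      (∀ z, |τ z| ≤ M) → (∀ z, |p z| ≤ M) → (∀ z, z.1 ∉ Ω → τ z = 0) →
      (∀ z, z.1 ∉ Ω → p z = 0) → IsRegular Ω M τ p k (truncate N₀) :=
    fun τ p hτm hpm hτ hp hτ0 hp0 => ⟨by positivity, hτm, hpm, hkm, hτ, hp,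
      fun z => (hk z).trans (by linarith), hτ0, hp0, hk0,
      fun a b => (truncate_lipschitz hC₂ hN₀_diff hN₀_deriv a b).trans
        (mul_le_mul_of_nonneg_right (by linarith) (abs_nonneg _)), hN0⟩
  have hτ₁M : ∀ z, |τ₁ z| ≤ M := fun z => (hτ₁ z).trans (by linarith)
  have hτ₂M : ∀ z, |τ₂ z| ≤ M := fun z => (hτ₂ z).trans (by linarith)
  have hp₁M : ∀ z, |p₁ z| ≤ M := fun z => (hp₁ z).trans (by linarith)
  have hp₂M : ∀ z, |p₂ z| ≤ M := fun z => (hp₂ z).trans (by linarith)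
  have hr₁ := hreg τ₁ p₁ hτ₁m hp₁m hτ₁M hp₁M hτ₁0 hp₁0
  have hr₂ := hreg τ₂ p₂ hτ₂m hp₂m hτ₂M hp₂M hτ₂0 hp₂0
  -- Second-order limits can be compared only with a common attenuation; once the absorptions agree
  -- almost everywhere, `τ₁` represents both.
  have hr₂' := hreg τ₁ p₂ hτ₁m hp₂m hτ₁M hp₂M hτ₁0 hp₂0
  have hdiff : ∀ {f g : Space d × Velocity d → ℝ}, (∀ z, |f z| ≤ M) → (∀ z, |g z| ≤ M) →
      ∀ z, |f z - g z| ≤ 2 * M := fun hf hg z => by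
    have h1 := abs_le.1 (hf z)
    have h2 := abs_le.1 (hg z)
    exact abs_le.2 ⟨by linarith, by linarith⟩
  have hM2 : M ≤ 2 * M := by linarith [hr₁.nonneg]
  have htrunc : ∀ a, |a| ≤ 1 → N₀ a = truncate N₀ a := fun a ha => (truncate_eq ha).symm
  have hττ : ∀ᵐ z ∂(phaseMeasure Ω), τ₁ z - τ₂ z = 0 := by
    -- The first-order limit gives plain ray integrals of the absorption, so the attenuation is
    -- taken to be zero.
    refine ae_eq_zero_of_ae_ray_integral_eq_zero (M := 2 * M) (σ := fun _ => 0) hΩ_open hΩ_bdd hT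
      (hτ₁m.sub hτ₂m) (hdiff hτ₁M hτ₂M)
      (fun z hz => by rw [hτ₁0 z hz, hτ₂0 z hz, sub_zero]) measurable_const
      (fun _ => by simpa using hr₁.nonneg) ?_
    filter_upwards [ae_exists_isSmallRaySolution hd hΩ_open hΩ_bdd hΩ_conv hΩ_smooth hT hr₁ hr₂
      hστ₁ hστ₂ hqp₁ hqp₂ hμk hC₁.le (abs_truncate_le hl hC₁ hN₀) htrunc hδ hA] with z hz
    obtain ⟨C, lam, F₁, F₂, K₁, K₂, h₁, h₂, hF⟩ := hz
    simp only [intervalIntegral.integral_zero, neg_zero, Real.exp_zero, mul_one]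
    rw [intervalIntegral.integral_sub (intervalIntegrable_along hτ₁m hτ₁M z 0 T)
      (intervalIntegrable_along hτ₂m hτ₂M z 0 T), h₁.integral_absorption_eq h₂ hF, sub_self]
  have hστ₂' : σ₂ =ᵐ[phaseMeasure Ω] τ₁ := by
    filter_upwards [hστ₂, hττ] with z h1 h2
    rw [h1, sub_eq_zero.1 h2]
  have hpp : ∀ᵐ z ∂(phaseMeasure Ω), p₁ z - p₂ z = 0 := by
    refine ae_eq_zero_of_ae_ray_integral_eq_zero (M := 2 * M) (σ := τ₁) hΩ_open hΩ_bdd hT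
      (hp₁m.sub hp₂m) (hdiff hp₁M hp₂M)
      (fun z hz => by rw [hp₁0 z hz, hp₂0 z hz, sub_zero]) hτ₁m
      (fun z => (hτ₁M z).trans hM2) ?_
    filter_upwards [ae_exists_isSmallRaySolution hd hΩ_open hΩ_bdd hΩ_conv hΩ_smooth hT hr₁ hr₂'
      hστ₁ hστ₂' hqp₁ hqp₂ hμk hC₁.le (abs_truncate_le hl hC₁ hN₀) htrunc hδ hA] with z hz
    obtain ⟨C, lam, F₁, F₂, K₁, K₂, h₁, h₂, hF⟩ := hz
    have hexp : Continuous fun s : ℝ =>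
        Real.exp (-∫ r in 0..s, τ₁ (z.1 + r • (z.2 : Space d), z.2)) :=
      (intervalIntegral.continuous_primitive (intervalIntegrable_along hτ₁m hτ₁M z) 0).neg.rexp
    simp only [sub_mul]
    rw [intervalIntegral.integral_sub
      ((intervalIntegrable_along hp₁m hp₁M z 0 T).mul_continuousOn hexp.continuousOn)
      ((intervalIntegrable_along hp₂m hp₂M z 0 T).mul_continuousOn hexp.continuousOn),
      h₁.attenuated_integral_eq h₂ hF
        (isLittleO_truncate hl hN₀ hN₀_diff hN₀_deriv hN₀_diff₂) (half_pos hN₀_pos).ne', sub_self]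
  have hqq : q₁ =ᵐ[phaseMeasure Ω] q₂ := by
    filter_upwards [hqp₁, hqp₂, hpp] with z h1 h2 h3
    rw [h1, h2, sub_eq_zero.1 h3]
  exact ⟨hστ₁.trans hστ₂'.symm, hqq, hqq.mono fun z hz y => by rw [hz]⟩
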